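/- Let $k$ be a field of characteristic $p>0$, and let $X$ be a separated scheme of finite type over $k$, of pure dimension $n$ (every irreducible component has dimension $n$). Let $X^{\mathrm{sm}}\subseteq X$ denote the open locus where $X$ is smooth over $k$, and let $x\in X^{\mathrm{sm}}$ be a point. Let $D_1,\dots,D_m$ ($m\ge 0$) be irreducible divisors of $X$ (irreducible closed subsets of codimension $1$, with the reduced scheme structure) that intersect transversely at $x$ over $k$: every $D_i$ contains $x$, and on some affine open neighbourhood $V$ of $x$ the ideal of $D_i$ is generated by one function $g_i\in\mathcal O_X(V)$, $i=1,\dots,m$, such that the differentials $dg_1(x),\dots,dg_m(x)$ are linearly independent over the residue field $\kappa(x)$ in $\Omega_{X/k}\otimes\kappa(x)$. Then there exist an open subset $U\subseteq X$ containing $x$, a finite étale morphism of $k$-schemes $f\colon U\to\mathbb A^n_k=\operatorname{Spec} k[t_1,\dots,t_n]$, and an injection $\sigma\colon\{1,\dots,m\}\to\{1,\dots,n\}$ such that $f(D_i\cap U)\subseteq\{t_{\sigma(i)}=0\}$ for $i=1,\dots,m$, and such that $U$ is dense in $X^{\mathrm{sm}}$, i.e. $X^{\mathrm{sm}}\subseteq\overline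 U$. In particular, $U$ is dense in $X$ whenever $X^{\mathrm{sm}}$ is dense in $X$ (for instance, whenever $X$ is irreducible or geometrically reduced). -/

import Mathlib

open AlgebraicGeometry CategoryTheory TopologicalSpace
open scoped TensorProduct

universe u

namespace EtaleCovers

/-- Every irreducible component of the topological space `T` has Krull dimension `n`. -/
def IsPureDimensional (T : Type*) [TopologicalSpace T] (n : ℕ) : Prop :=
  ∀ Z ∈ irreducibleComponents T, topologicalKrullDim Z = n

/-- The `k`-algebra structure on `Γ(X, V)` of a `k`-scheme `π : X ⟶ Spec k`. -/
noncomputable abbrev sectionsAlgebra {k : Type u} [Field k] {X : Scheme.{u}}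
    (π : X ⟶ Spec (.of k)) (V : X.Opens) : Algebra k Γ(X, V) :=
  (π.appLE ⊤ V le_top).hom.comp (Scheme.ΓSpecIso (.of k)).inv.hom |>.toAlgebra

/-- For `g` a regular function on a neighbourhood `V` of `x`, the value `dg(x)` of its
differential in the fibre `κ(x) ⊗ Ω_{X/k}` of the cotangent sheaf; linear independence over `κ(x)`
of a family of such values. -/
def LinearIndependentDifferentialsAt {k : Type u} [Field k] {X : Scheme.{u}}
    (π : X ⟶ Spec (.of k)) (V : X.Opens) (x : X) (hx : x ∈ V)
    {ι : Type*} (g : ι → Γ(X, V)) : Prop :=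
  letI : Algebra k Γ(X, V) := sectionsAlgebra π V
  letI : Algebra Γ(X, V) (X.residueField x) := (X.evaluation V x hx).hom.toAlgebra
  LinearIndependent (X.residueField x) fun i ↦
    (1 : X.residueField x) ⊗ₜ[Γ(X, V)] KaehlerDifferential.D k Γ(X, V) (g i)

/-- The irreducible closed subsets `D i`, with their reduced scheme structure, intersect
transversely at `x` (relatively to `k`): they all contain `x`, and on some affine neighbourhood of
`x` they are cut out by single equations `g i` whose differentials at `x` are linearly independent
in `κ(x) ⊗ Ω_{X/k}`. -/
def IntersectTransverselyAt {k : Type u} [Field k] {X : Scheme.{u}}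
    (π : X ⟶ Spec (.of k)) {ι : Type*} (D : ι → IrreducibleCloseds X) (x : X) : Prop :=
  (∀ i, x ∈ D i) ∧
    ∃ (V : X.affineOpens) (hx : x ∈ V.1) (g : ι → Γ(X, V.1)),
      (∀ i, (Scheme.IdealSheafData.vanishingIdeal ⟨D i, (D i).isClosed⟩).ideal V =
        Ideal.span {g i}) ∧
      LinearIndependentDifferentialsAt π V.1 x hx g

/-- Affine `n`-space over `k`. -/
noncomputable abbrev affineSpace (n : ℕ) (k : Type u) [Field k] : Scheme.{u} :=
  𝔸(ULift.{u} (Fin n); Spec (.of k))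

/-- The coordinate hyperplane `t_j = 0` of affine `n`-space. -/
def coordinateHyperplane {n : ℕ} (k : Type u) [Field k] (j : Fin n) : Set (affineSpace n k) :=
  (affineSpace n k).zeroLocus (U := ⊤) {AffineSpace.coord (Spec (.of k)) (ULift.up j)}

end EtaleCovers

/-! The construction has two independent halves: find an affine open `U` with étale coordinates,
then make those coordinates finite.

Near `x` the `g i` extend to étale coordinates, because a basis of the fibre of `Ω` at a smooth
point is a basis of its stalk, and a basis of differentials means étaleness
(`formallyEtale_mvPolynomial_iff`). Pure dimension fixes their number. A disjoint union of two étale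
charts is again a chart, so a maximal chart containing `x`, which exists because `X` is Noetherian,
is dense in the smooth locus: otherwise a small chart disjoint from it and from all `D i` could be
added.

On such a chart put `t i = z i + (z i * h i) ^ p`. In characteristic `p` this has the same
differential as `z i`, so `t` is étale for every `h`; it is divisible by `z i`, so it still vanishes
on `D i`. It remains to choose `h` with `t` finite (`exists_forall_isIntegral_adjoin_add_pow`).

By quasi-finiteness, the locus where at least `n - s` of the `z i` vanish has dimension at most `s`.
Noether normalization therefore gives `w 0, …, w (n - 1)`, with `w s` vanishing on that locus, over
which `A` is integral. Let `G = ∑ w s T ^ s` and `h i = W i ^ N`, where `W i` is the value of `G` at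
the `i`-th of `n` distinct constants. A finite field may have too few constants, so pairwise coprime
polynomials and resultants replace them.

Integrality is tested on valuations. Suppose all `t i` are integral and `M = max v (w s) > 1`. Where
`v (W i) ≥ M`, integrality of `t i` forces `z i` to be so small that the `w s` lying in the ideal of
these `z i` are integral. At the remaining nodes `G` is smaller than `M`, and interpolation makes
the remaining `w s` smaller than `M`. So no `w s` attains `M`, a contradiction. -/

namespace EtaleCovers

/-! ### Integrality and growth tested by valuations -/

section Valuations

/-- An element `a` of a ring `A` is integral over a subring `S` as soon as every valuation with
values in an algebraically closed field that is integral on `S` is integral at `a`. -/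
theorem isIntegral_of_forall_valuationSubring {k : Type*} {A : Type u} [CommRing k] [CommRing A]
    [Algebra k A] (S : Subalgebra k A) (a : A)
    (h : ∀ (K : Type u) [Field K] [IsAlgClosed K] (φ : A →+* K) (V : ValuationSubring K),
      (∀ s ∈ S, φ s ∈ V) → φ a ∈ V) : IsIntegral S a := by
  -- Non-integrality of `a` says exactly that `0 ∉ T`. A prime disjoint from `T` then preserves it,
  -- which reduces to a field, where the integral closure is the intersection of the valuation
  -- rings.
  let T : Submonoid A :=
    { carrier := {b | ∃ f : Polynomial S, f.Monic ∧ Polynomial.aeval a f = b}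
      one_mem' := ⟨1, Polynomial.monic_one, by simp⟩
      mul_mem' := by
        rintro _ _ ⟨f, hf, rfl⟩ ⟨g, hg, rfl⟩
        exact ⟨f * g, hf.mul hg, by simp⟩ }
  by_contra hintegral
  have hT : Disjoint ((⊥ : Ideal A) : Set A) T := by
    rw [Set.disjoint_left]
    rintro _ h0 ⟨f, hf, rfl⟩
    exact hintegral ⟨f, hf, by simpa [Polynomial.aeval_def] using h0⟩
  obtain ⟨q, hq, -, hqT⟩ := Ideal.exists_le_prime_disjoint _ _ hT
  let K := AlgebraicClosure (FractionRing (A ⧸ q))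
  let ι : A ⧸ q →+* K := (algebraMap (FractionRing (A ⧸ q)) K).comp (algebraMap (A ⧸ q) _)
  have hι : Function.Injective ι :=
    (algebraMap (FractionRing (A ⧸ q)) K).injective.comp (IsFractionRing.injective (A ⧸ q) _)
  let φ : A →+* K := ι.comp (Ideal.Quotient.mk q)
  have hφ (b : A) : φ b = 0 ↔ b ∈ q := by
    rw [RingHom.comp_apply, map_eq_zero_iff _ hι, Ideal.Quotient.eq_zero_iff_mem]
  let ψ : S →+* K := φ.comp S.val.toRingHom
  have hmem : φ a ∈ (integralClosure (Subring.closure (ψ.range : Set K)) K).toSubring := by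
    rw [← iInf_valuationSubring_superset, Subring.mem_iInf]
    rintro ⟨V, hV⟩
    exact h K φ V fun s hs ↦ hV ⟨⟨s, hs⟩, rfl⟩
  obtain ⟨f, hf, hfa⟩ : IsIntegral (Subring.closure (ψ.range : Set K)) (φ a) := hmem
  have hle : Subring.closure (ψ.range : Set K) ≤ ψ.range := by
    rw [Subring.closure_le]
  have hl : f.map (Subring.closure (ψ.range : Set K)).subtype ∈ Polynomial.lifts ψ := by
    rw [Polynomial.lifts_iff_coeff_lifts]
    intro i
    rw [Polynomial.coeff_map]
    exact hle (f.coeff i).2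
  obtain ⟨g, hg, -, hgm⟩ := Polynomial.lifts_and_natDegree_eq_and_monic hl (hf.map _)
  refine Set.disjoint_left.mp hqT ((hφ (Polynomial.aeval a g)).mp ?_) ⟨g, hgm, rfl⟩
  have h1 : φ (Polynomial.aeval a g) = g.eval₂ ψ (φ a) := by
    rw [Polynomial.aeval_def, Polynomial.hom_eval₂]; rfl
  rw [h1, ← Polynomial.eval_map, hg, Polynomial.eval_map]
  exact hfa

/-- Version of `isIntegral_of_forall_valuationSubring` for valuations on the ring. -/
theorem isIntegral_of_forall_valuation {k : Type*} {A : Type u} [CommRing k] [CommRing A]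
    [Algebra k A] (S : Subalgebra k A) (a : A)
    (h : ∀ (Γ₀ : Type u) [LinearOrderedCommGroupWithZero Γ₀] (v : Valuation A Γ₀),
      (∀ s ∈ S, v s ≤ 1) → v a ≤ 1) : IsIntegral S a :=
  isIntegral_of_forall_valuationSubring S a fun _ _ _ φ V hV ↦
    (V.valuation_le_one_iff _).mp <| h V.ValueGroup (V.valuation.comap φ)
      fun s hs ↦ (V.valuation_le_one_iff _).mpr (hV s hs)

/-- If `A` is integral over `k[u]`, then every valuation grows at most polynomially in terms of
its values at `u`, with a uniform exponent. -/
theorem exists_forall_valuation_le_pow {k : Type*} {A : Type u} {ι : Type*} [Field k] [CommRing A]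
    [Algebra k A] (w : ι → A) (b : A) (hb : IsIntegral (Algebra.adjoin k (Set.range w)) b) :
    ∃ E : ℕ, ∀ (Γ₀ : Type u) [LinearOrderedCommGroupWithZero Γ₀] (v : Valuation A Γ₀) (M : Γ₀),
      (∀ c : k, v (algebraMap k A c) ≤ 1) → 1 ≤ M → (∀ i, v (w i) ≤ M) → v b ≤ M ^ E := by
  have key : ∀ a ∈ Algebra.adjoin k (Set.range w), ∃ E : ℕ,
      ∀ (Γ₀ : Type u) [LinearOrderedCommGroupWithZero Γ₀] (v : Valuation A Γ₀) (M : Γ₀),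
      (∀ c : k, v (algebraMap k A c) ≤ 1) → 1 ≤ M → (∀ i, v (w i) ≤ M) → v a ≤ M ^ E := by
    intro a ha
    induction ha using Algebra.adjoin_induction with
    | mem x hx =>
      obtain ⟨i, rfl⟩ := hx
      exact ⟨1, fun _ _ v M _ _ h ↦ by simpa using h i⟩
    | algebraMap c => exact ⟨0, fun _ _ v M h _ _ ↦ by simpa using h c⟩
    | add x y _ _ hx hy =>
      obtain ⟨E, hE⟩ := hx
      obtain ⟨F, hF⟩ := hy
      refine ⟨max E F, fun Γ₀ _ v M h1 h2 h3 ↦ v.map_add_le ?_ ?_⟩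
      · exact (hE Γ₀ v M h1 h2 h3).trans (pow_le_pow_right₀ h2 (le_max_left _ _))
      · exact (hF Γ₀ v M h1 h2 h3).trans (pow_le_pow_right₀ h2 (le_max_right _ _))
    | mul x y _ _ hx hy =>
      obtain ⟨E, hE⟩ := hx
      obtain ⟨F, hF⟩ := hy
      refine ⟨E + F, fun Γ₀ _ v M h1 h2 h3 ↦ ?_⟩
      rw [map_mul, pow_add]
      exact mul_le_mul' (hE Γ₀ v M h1 h2 h3) (hF Γ₀ v M h1 h2 h3)
  obtain ⟨f, hf, hfb⟩ := hb
  choose E hE using fun i ↦ key (f.coeff i) (f.coeff i).2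
  -- If `v b` exceeded this power of `M`, it would exceed the value of every lower coefficient, and
  -- the leading term of the monic equation would dominate.
  refine ⟨(Finset.range f.natDegree).sup E, fun Γ₀ _ v M h1 h2 h3 ↦ ?_⟩
  by_contra! hlt
  have hb1 : 1 < v b := (one_le_pow₀ h2).trans_lt hlt
  have hb0 : 0 < v b := zero_lt_one.trans hb1
  have hsum : b ^ f.natDegree = -∑ i ∈ Finset.range f.natDegree, (f.coeff i : A) * b ^ i := by
    rw [Polynomial.eval₂_eq_sum_range, Finset.sum_range_succ, hf.coeff_natDegree, map_one,
      one_mul] at hfb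
    exact eq_neg_of_add_eq_zero_right hfb
  have : v (b ^ f.natDegree) < v b ^ f.natDegree := by
    rw [hsum, Valuation.map_neg]
    refine v.map_sum_lt (pow_ne_zero _ hb0.ne') fun i hi ↦ ?_
    rw [map_mul, map_pow]
    have hi' := Finset.mem_range.mp hi
    calc v (f.coeff i : A) * v b ^ i < v b * v b ^ i :=
          mul_lt_mul_of_pos_right (((hE i Γ₀ v M h1 h2 h3).trans
            (pow_le_pow_right₀ h2 (Finset.le_sup hi))).trans_lt hlt) (pow_pos hb0 _)
      _ = v b ^ (i + 1) := by rw [pow_succ']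
      _ ≤ v b ^ f.natDegree := pow_le_pow_right₀ hb1.le hi'
  rw [map_pow] at this
  exact this.false

/-- Nagata's change of variables: a polynomial `F` without constant term can be used to eliminate
one of `s + 1` elements, up to integral extension. -/
theorem exists_isIntegral_adjoin_insert_aeval {k : Type*} {A : Type u} [Field k] [CommRing A]
    [Algebra k A] {s : ℕ} (x : Fin (s + 1) → A) (F : MvPolynomial (Fin (s + 1)) k) (hF : F ≠ 0)
    (hF0 : F.coeff 0 = 0) :
    ∃ y : Fin s → A, ∀ i, IsIntegral
      (Algebra.adjoin k (insert (MvPolynomial.aeval x F) (Set.range y))) (x i) := by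
  -- `r` exceeds every exponent in `F`, so exponent vectors are digit strings in base `r` and
  -- distinct monomials get distinct weights `e d`.
  let r := 2 + F.totalDegree
  let y : Fin s → A := fun i ↦ x i.succ - x 0 ^ r ^ (i.1 + 1)
  let S := Algebra.adjoin k (insert (MvPolynomial.aeval x F) (Set.range y))
  have hyS (i) : y i ∈ S := Algebra.subset_adjoin (Set.mem_insert_of_mem _ ⟨i, rfl⟩)
  have hFS : MvPolynomial.aeval x F ∈ S := Algebra.subset_adjoin (Set.mem_insert _ _)
  have h0 : IsIntegral S (x 0) := by
    refine isIntegral_of_forall_valuation S _ fun Γ₀ _ v hv ↦ ?_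
    by_contra! hlt
    have hk (c : k) (hc : c ≠ 0) : v (algebraMap k A c) = 1 := by
      refine le_antisymm (hv _ (S.algebraMap_mem c)) ?_
      have h1 := hv _ (S.algebraMap_mem c⁻¹)
      have h2 : v (algebraMap k A c) * v (algebraMap k A c⁻¹) = 1 := by
        rw [← map_mul, ← map_mul, mul_inv_cancel₀ hc, map_one, map_one]
      calc (1 : Γ₀) = v (algebraMap k A c) * v (algebraMap k A c⁻¹) := h2.symm
        _ ≤ v (algebraMap k A c) * 1 := by gcongr
        _ = _ := mul_one _
    have hx (i) : v (x i) = v (x 0) ^ r ^ i.1 := by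
      cases i using Fin.cases with
      | zero => simp
      | succ i =>
        have hlt' : v (y i) < v (x 0 ^ r ^ (i.1 + 1)) := by
          rw [map_pow]
          exact (hv _ (hyS i)).trans_lt (one_lt_pow₀ hlt (by positivity))
        have : x i.succ = y i + x 0 ^ r ^ (i.1 + 1) := by simp [y]
        rw [this, Valuation.map_add_eq_of_lt_right _ hlt', map_pow, Fin.val_succ]
    let e : (Fin (s + 1) →₀ ℕ) → ℕ := fun d ↦ ∑ i, r ^ i.1 * d i
    have hmon (d) (hd : d ∈ F.support) :
        v (MvPolynomial.aeval x (MvPolynomial.monomial d (F.coeff d))) = v (x 0) ^ e d := by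
      rw [MvPolynomial.aeval_monomial, map_mul, hk _ (MvPolynomial.mem_support_iff.mp hd), one_mul,
        Finsupp.prod_fintype _ _ (fun i ↦ pow_zero _), map_prod]
      rw [← Finset.prod_pow_eq_pow_sum]
      exact Finset.prod_congr rfl fun i _ ↦ by rw [map_pow, hx, pow_mul]
    have hinj : Set.InjOn e F.support := by
      intro d hd d' hd' hdd
      have hlt (d) (hd : d ∈ F.support) (i) : d i < r :=
        lt_of_le_of_lt ((MvPolynomial.monomial_le_degreeOf i hd).trans
          (MvPolynomial.degreeOf_le_totalDegree F i)) (by omega)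
      have hl (d) (hd : d ∈ F.support) : ∀ l ∈ List.ofFn d, l < r := by
        intro l hl
        obtain ⟨i, rfl⟩ := List.mem_ofFn.mp hl
        exact hlt d hd i
      refine Finsupp.ext <| congrFun <| List.ofFn_inj.mp ?_
      apply Nat.ofDigits_inj_of_len_eq (show 1 < r by omega) (by simp) (hl d hd) (hl d' hd')
      simpa only [Nat.ofDigits_eq_sum_mapIdx, List.mapIdx_eq_ofFn, List.get_ofFn, List.length_ofFn,
        Fin.val_cast, mul_comm, List.sum_ofFn, e] using! hdd
    obtain ⟨d, hd, hmax⟩ := F.support.exists_max_image e (MvPolynomial.support_nonempty.mpr hF)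
    -- This is where the missing constant term is used: the dominant monomial has positive weight,
    -- so `F` takes a non-integral value.
    have hed : e d ≠ 0 := by
      intro h
      have : d = 0 := by
        ext i
        have := (Finset.sum_eq_zero_iff.mp h) i (Finset.mem_univ _)
        simpa [show r ≠ 0 by omega] using this
      subst this
      exact MvPolynomial.mem_support_iff.mp hd hF0
    have hvF : v (MvPolynomial.aeval x F) = v (x 0) ^ e d := by
      rw [← hmon d hd]
      conv_lhs => rw [← F.support_sum_monomial_coeff, map_sum]
      refine Valuation.map_sum_eq_of_lt v hd fun d' hd' ↦ ?_
      obtain ⟨hd', hne⟩ := Finset.mem_sdiff.mp hd'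
      rw [hmon d hd, hmon d' hd']
      exact pow_lt_pow_right₀ hlt (lt_of_le_of_ne (hmax d' hd')
        fun h ↦ hne (by simpa using hinj hd' hd h))
    exact absurd (hv _ hFS) (by rw [hvF, not_le]; exact one_lt_pow₀ hlt hed)
  refine ⟨y, fun i ↦ ?_⟩
  cases i using Fin.cases with
  | zero => exact h0
  | succ i =>
    have : x i.succ = y i + x 0 ^ r ^ (i.1 + 1) := by simp [y]
    rw [this]
    exact (isIntegral_algebraMap (R := S) (x := ⟨y i, hyS i⟩)).add (h0.pow _)

end Valuations

/-! ### Noether normalization adapted to the vanishing of coordinates; interpolation -/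

section Normalization

theorem isIntegral_of_isIntegral_adjoin {k A : Type*} [CommRing k] [CommRing A] [Algebra k A]
    (S : Subalgebra k A) {T : Set A} (hT : ∀ t ∈ T, IsIntegral S t) {a : A}
    (ha : IsIntegral (Algebra.adjoin k T) a) : IsIntegral S a := by
  let C := integralClosure S A
  have hle : Algebra.adjoin k T ≤ C.restrictScalars k := Algebra.adjoin_le hT
  have : IsIntegral C a :=
    ha.map_of_comp_eq (Subalgebra.inclusion hle).toRingHom (RingHom.id A) (by ext; rfl)
  exact isIntegral_trans a this

/-- Noether normalization relative to a sequence of ideals: if `s + 1` elements are always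
algebraically dependent modulo `I s`, then the normalizing elements can be chosen in these
ideals. -/
theorem exists_mem_ideal_isIntegral_adjoin {k : Type*} {A : Type u} [Field k] [CommRing A]
    [Algebra k A] (I : ℕ → Ideal A)
    (hI : ∀ (s : ℕ) (y : Fin (s + 1) → A), ∃ F : MvPolynomial (Fin (s + 1)) k,
      F ≠ 0 ∧ MvPolynomial.aeval y F ∈ I s) (s : ℕ) (x : Fin s → A) :
    ∃ w : ℕ → A, (∀ j, w j ∈ I j) ∧ (∀ j, s ≤ j → w j = 0) ∧
      ∀ i, IsIntegral (Algebra.adjoin k (Set.range w)) (x i) := by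
  induction s with
  | zero => exact ⟨0, fun j ↦ zero_mem _, fun _ _ ↦ rfl, fun i ↦ i.elim0⟩
  | succ s ih =>
    obtain ⟨F, hF, hFI⟩ := hI s x
    -- The factor `X 0` removes the constant term while the value stays in the ideal `I s`. The slot
    -- `w s` is still zero, so overwriting it loses nothing.
    obtain ⟨y, hy⟩ := exists_isIntegral_adjoin_insert_aeval x (MvPolynomial.X 0 * F)
      (mul_ne_zero (MvPolynomial.X_ne_zero _) hF) (by rw [← MvPolynomial.constantCoeff_eq]; simp)
    obtain ⟨w, hwI, hw0, hw⟩ := ih y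
    set f := MvPolynomial.aeval x (MvPolynomial.X 0 * F)
    have hf : f ∈ I s := by
      simp only [f, map_mul]
      exact Ideal.mul_mem_left _ _ hFI
    have hle : Algebra.adjoin k (Set.range w) ≤
        Algebra.adjoin k (Set.range (Function.update w s f)) := by
      refine Algebra.adjoin_le ?_
      rintro _ ⟨j, rfl⟩
      by_cases hj : j = s
      · subst hj
        rw [hw0 j le_rfl]
        exact zero_mem _
      · exact Algebra.subset_adjoin ⟨j, by simp [hj]⟩
    refine ⟨Function.update w s f, fun j ↦ ?_, fun j hj ↦ ?_, fun i ↦ ?_⟩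
    · by_cases hj : j = s
      · subst hj; simpa using hf
      · simpa [hj] using hwI j
    · simpa [show j ≠ s by omega] using hw0 j (by omega)
    · refine isIntegral_of_isIntegral_adjoin _ ?_ (hy i)
      rintro t (rfl | ⟨j, rfl⟩)
      · exact isIntegral_algebraMap (R := Algebra.adjoin k (Set.range (Function.update w s f)))
          (x := ⟨f, Algebra.subset_adjoin ⟨s, by simp⟩⟩)
      · exact (hw j).map_of_comp_eq (Subalgebra.inclusion hle).toRingHom (RingHom.id A)
          (by ext; rfl)

/-- The ideal of functions vanishing wherever at least `n - s` of the functions `z` vanish. -/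
def vanishingOrderIdeal {A : Type*} [CommRing A] {n : ℕ} (z : Fin n → A) (s : ℕ) : Ideal A :=
  (Finset.univ.filter fun J : Finset (Fin n) ↦ n ≤ J.card + s).inf fun J ↦ Ideal.span (z '' J)

theorem vanishingOrderIdeal_le {A : Type*} [CommRing A] {n : ℕ} (z : Fin n → A) {s : ℕ}
    {J : Finset (Fin n)} (hJ : n ≤ J.card + s) : vanishingOrderIdeal z s ≤ Ideal.span (z '' J) :=
  Finset.inf_le (f := fun J : Finset (Fin n) ↦ Ideal.span (z '' J)) (by simpa using hJ)

theorem vanishingOrderIdeal_eq_bot {A : Type*} [CommRing A] {n : ℕ} (z : Fin n → A) {s : ℕ}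
    (hs : n ≤ s) : vanishingOrderIdeal z s = ⊥ :=
  le_bot_iff.mp <| (vanishingOrderIdeal_le z (J := ∅) (by simpa using hs)).trans (by simp)

/-- A dimension bound in algebraic form. If no relation existed, some prime `q` above the ideal
would keep the `s + 1` elements `y` independent. A prime containing a finite intersection contains
one of the ideals, so `q` contains some `z '' J`; then `A ⧸ q` is algebraic over the at most `s`
remaining coordinates. -/
theorem exists_aeval_mem_vanishingOrderIdeal {k A : Type*} [Field k] [CommRing A] [Algebra k A]
    {n : ℕ} (z : Fin n → A)
    (hz : ∀ (q : Ideal A) [q.IsPrime], Algebra.IsAlgebraic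
      (Algebra.adjoin k (Set.range fun i ↦ Ideal.Quotient.mk q (z i))) (A ⧸ q))
    (s : ℕ) (y : Fin (s + 1) → A) : ∃ F : MvPolynomial (Fin (s + 1)) k,
      F ≠ 0 ∧ MvPolynomial.aeval y F ∈ vanishingOrderIdeal z s := by
  by_contra! hcon
  let T : Submonoid A := (nonZeroDivisors (MvPolynomial (Fin (s + 1)) k)).map
    (MvPolynomial.aeval (R := k) y)
  have hT : Disjoint (vanishingOrderIdeal z s : Set A) T := by
    rw [Set.disjoint_right]
    rintro _ ⟨F, hF, rfl⟩
    exact hcon F (nonZeroDivisors.ne_zero hF)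
  obtain ⟨q, hq, hle, hqT⟩ := Ideal.exists_le_prime_disjoint _ _ hT
  obtain ⟨J, hJ, hJq⟩ := (Ideal.IsPrime.inf_le' hq).mp hle
  have hJ : n ≤ J.card + s := by simpa using hJ
  have hind : AlgebraicIndependent k fun i ↦ Ideal.Quotient.mk q (y i) := by
    refine (injective_iff_map_eq_zero _).mpr fun F hF ↦ ?_
    by_contra hF0
    have h1 : Ideal.Quotient.mk q (MvPolynomial.aeval y F) = 0 := by
      rw [← hF]
      exact MvPolynomial.comp_aeval_apply _ (Ideal.Quotient.mkₐ k q) F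
    exact Set.disjoint_left.mp hqT (Ideal.Quotient.eq_zero_iff_mem.mp h1)
      ⟨F, mem_nonZeroDivisors_of_ne_zero hF0, rfl⟩
  let Z : Finset (A ⧸ q) := by
    classical exact Jᶜ.image fun i ↦ Ideal.Quotient.mk q (z i)
  have hZ : Algebra.adjoin k (Set.range fun i ↦ Ideal.Quotient.mk q (z i)) =
      Algebra.adjoin k (Z : Set (A ⧸ q)) := by
    refine le_antisymm (Algebra.adjoin_le ?_) (Algebra.adjoin_mono ?_)
    · rintro _ ⟨i, rfl⟩
      by_cases hi : i ∈ J
      · have : Ideal.Quotient.mk q (z i) = 0 :=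
          Ideal.Quotient.eq_zero_iff_mem.mpr (hJq (Ideal.subset_span ⟨i, hi, rfl⟩))
        simp only [this]
        exact zero_mem _
      · exact Algebra.subset_adjoin (by simpa [Z] using ⟨i, hi, rfl⟩)
    · intro a ha
      obtain ⟨i, -, rfl⟩ : ∃ i, i ∉ J ∧ Ideal.Quotient.mk q (z i) = a := by simpa [Z] using ha
      exact ⟨i, rfl⟩
  have halg := hz q
  rw [hZ] at halg
  have h1 := Algebra.IsAlgebraic.trdeg_le_cardinalMk k (Z : Set (A ⧸ q))
  have h2 := hind.lift_cardinalMk_le_trdeg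
  have h3 : Z.card ≤ n - J.card := by
    classical
    refine Finset.card_image_le.trans ?_
    simp [Finset.card_compl]
  have h4 := h2.trans (Cardinal.lift_le.mpr h1)
  simp only [Cardinal.mk_fin, Cardinal.lift_natCast, Cardinal.mk_coe_finset, Finset.coe_sort_coe,
    Nat.cast_le] at h4
  omega

/-- Euclid's argument, in Sylvester's form: with `Q (i + 1) = Q i * (Q i + 1)`, each `Q i + 1`
divides all later `Q j`, hence is coprime to `Q j + 1`. Roots of these polynomials replace distinct
elements of `k`, which may be finite. -/
theorem exists_monic_pairwise_isCoprime (k : Type*) [Field k] :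
    ∃ P : ℕ → Polynomial k, (∀ i, (P i).Monic) ∧ (∀ i, (P i).natDegree ≠ 0) ∧
      Pairwise fun i j ↦ IsCoprime (P i) (P j) := by
  let Q : ℕ → Polynomial k := fun i ↦ Nat.rec Polynomial.X (fun _ q ↦ q * (q + 1)) i
  have hQ (i) : Q (i + 1) = Q i * (Q i + 1) := rfl
  have hdeg (i) : (Q i).Monic ∧ 0 < (Q i).degree := by
    induction i with
    | zero => exact ⟨Polynomial.monic_X, by simp [Q]⟩
    | succ i ih =>
      have h1 : (Q i + 1).Monic := ih.1.add_of_left (by simpa using ih.2)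
      refine ⟨hQ i ▸ ih.1.mul h1, ?_⟩
      rw [hQ, Polynomial.degree_mul]
      exact ih.2.trans_le (le_add_of_nonneg_right
        (Polynomial.zero_le_degree_iff.mpr h1.ne_zero))
  have hdvd {i j} (hij : i < j) : Q i + 1 ∣ Q j := by
    induction j, hij using Nat.le_induction with
    | base => exact ⟨Q i, by rw [hQ, mul_comm]⟩
    | succ j _ ih => exact ih.trans ⟨_, hQ j⟩
  have hcop {i j} (hij : i < j) : IsCoprime (Q i + 1) (Q j + 1) := by
    have : IsCoprime (Q j) (Q j + 1) := ⟨-1, 1, by ring⟩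
    exact this.of_isCoprime_of_dvd_left (hdvd hij)
  refine ⟨fun i ↦ Q i + 1, fun i ↦ (hdeg i).1.add_of_left (by simpa using (hdeg i).2),
    fun i ↦ ?_, fun i j hij ↦ ?_⟩
  · have : (Q i + 1).natDegree = (Q i).natDegree := by
      simpa using Polynomial.natDegree_add_C (p := Q i) (a := 1)
    rw [this]
    exact (Polynomial.natDegree_pos_iff_degree_pos.mpr (hdeg i).2).ne'
  · rcases lt_or_gt_of_ne hij with h | h
    · exact hcop h
    · exact (hcop h).symm

/-- A polynomial of degree less than the number of nodes which is small at nodes that are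
algebraic over a trivially valued field has small coefficients. -/
theorem valuation_coeff_lt_of_eval_lt {K ι : Type*} [Field K] [DecidableEq ι]
    (V : ValuationSubring K)
    (L : Subfield K) (hL : ∀ x ∈ L, x ∈ V) (s : Finset ι) (node : ι → K) (hnode : ∀ i, node i ∈ L)
    (hinj : Set.InjOn node s) (Q : Polynomial K) (hQ : Q.degree < s.card) (M : V.ValueGroup)
    (hM : 0 < M) (hlt : ∀ i ∈ s, V.valuation (Q.eval (node i)) < M) (m : ℕ) :
    V.valuation (Q.coeff m) < M := by
  -- Differences of nodes are inverted inside the subfield `L`, so the Lagrange basis has integral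
  -- coefficients and interpolation does not enlarge values.
  have hb (i) : Lagrange.basis s node i ∈ Polynomial.lifts L.subtype := by
    refine Subsemiring.prod_mem _ fun j _ ↦ ?_
    rw [Lagrange.basisDivisor, sub_eq_add_neg Polynomial.X, ← map_neg]
    exact mul_mem (Polynomial.C'_mem_lifts ⟨⟨_, inv_mem (sub_mem (hnode i) (hnode j))⟩, rfl⟩)
      (add_mem (Polynomial.X_mem_lifts _) (Polynomial.C'_mem_lifts ⟨⟨_, neg_mem (hnode j)⟩, rfl⟩))
  rw [Lagrange.eq_interpolate hinj hQ, Lagrange.interpolate_apply, Polynomial.finsetSum_coeff]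
  refine V.valuation.map_sum_lt hM.ne' fun i hi ↦ ?_
  rw [Polynomial.coeff_C_mul, map_mul]
  obtain ⟨c, hc⟩ := (Polynomial.lifts_iff_coeff_lifts _).mp (hb i) m
  refine (mul_le_of_le_one_right' ?_).trans_lt (hlt i hi)
  rw [V.valuation_le_one_iff, ← hc]
  exact hL _ c.2

end Normalization

/-! ### From quasi-finite to finite by adding `p`-th powers -/

section PowerPerturbation

/-- Elements of a field that are algebraic over a subfield contained in a valuation subring form
a subfield contained in this valuation subring. -/
theorem mem_valuationSubring_of_isAlgebraic {k K : Type*} [Field k] [Field K] [Algebra k K]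
    (V : ValuationSubring K) (hV : ∀ c : k, algebraMap k K c ∈ V) {x : K} (hx : IsAlgebraic k x) :
    x ∈ V := by
  have h : IsIntegral V x := hx.isIntegral.map_of_comp_eq
    ((algebraMap k K).codRestrict V.toSubring hV) (RingHom.id K) (by ext; rfl)
  obtain ⟨y, rfl⟩ := IsIntegrallyClosed.isIntegral_iff.mp h
  exact y.2

/-- Let `z` be functions on an affine scheme of finite type over `k` such that the associated map
to affine space is quasi-finite. Then each `z i` can be changed by the `p`-th power of a multiple
of `z i` so that the new map is integral. -/
theorem exists_forall_isIntegral_adjoin_add_pow {k : Type*} {A : Type u} [Field k] [CommRing A]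
    [Algebra k A] [Algebra.FiniteType k A] {p : ℕ} (hp : 2 ≤ p) {n : ℕ} (z : Fin n → A)
    (hz : ∀ (q : Ideal A) [q.IsPrime], Algebra.IsAlgebraic
      (Algebra.adjoin k (Set.range fun i ↦ Ideal.Quotient.mk q (z i))) (A ⧸ q)) :
    ∃ h : Fin n → A, ∀ a : A,
      IsIntegral (Algebra.adjoin k (Set.range fun i ↦ z i + (z i * h i) ^ p)) a := by
  obtain ⟨r, g, hg⟩ := Algebra.FiniteType.iff_quotient_mvPolynomial''.mp
    (inferInstance : Algebra.FiniteType k A)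
  obtain ⟨w, hwI, -, hw⟩ := exists_mem_ideal_isIntegral_adjoin (k := k) (vanishingOrderIdeal z)
    (exists_aeval_mem_vanishingOrderIdeal z hz) r fun i ↦ g (MvPolynomial.X i)
  have hw0 (s : ℕ) (hs : n ≤ s) : w s = 0 := by
    simpa [vanishingOrderIdeal_eq_bot z hs] using hwI s
  have hintegral (a : A) : IsIntegral (Algebra.adjoin k (Set.range w)) a := by
    have htop : Algebra.adjoin k (Set.range fun i ↦ g (MvPolynomial.X i)) = ⊤ := by
      rw [Set.range_comp' g, ← AlgHom.map_adjoin, MvPolynomial.adjoin_range_X, Algebra.map_top]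
      exact (AlgHom.range_eq_top g).mpr hg
    refine isIntegral_of_isIntegral_adjoin _ (T := Set.range fun i ↦ g (MvPolynomial.X i)) ?_ ?_
    · rintro _ ⟨i, rfl⟩
      exact hw i
    · exact isIntegral_algebraMap (x := (⟨a, htop ▸ Algebra.mem_top⟩ :
        Algebra.adjoin k (Set.range fun i ↦ g (MvPolynomial.X i))))
  obtain ⟨P, hPm, hPd, hPc⟩ := exists_monic_pairwise_isCoprime k
  let G : Polynomial A := ∑ s ∈ Finset.range n, Polynomial.C (w s) * Polynomial.X ^ s
  have hG : G.natDegree ≤ n := Polynomial.natDegree_sum_le_of_forall_le _ _ fun s hs ↦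
    (Polynomial.natDegree_C_mul_X_pow_le _ _).trans (Finset.mem_range.mp hs).le
  -- Since `P i` is monic, this is the product of the values of `G` at the roots of `P i`.
  let W : Fin n → A := fun i ↦
    Polynomial.resultant ((P i).map (algebraMap k A)) G (P i).natDegree n
  have hex (J : Finset (Fin n)) (s : ℕ) :
      ∃ b : Fin n → A, n ≤ J.card + s → w s = ∑ i ∈ J, b i * z i := by
    by_cases hJ : n ≤ J.card + s
    · obtain ⟨b, hb⟩ := (Submodule.mem_span_image_finset_iff_exists_fun A).mp
        (vanishingOrderIdeal_le z hJ (hwI s))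
      refine ⟨fun i ↦ if hi : i ∈ J then b ⟨i, hi⟩ else 0, fun _ ↦ ?_⟩
      rw [← hb, ← Finset.sum_coe_sort J]
      simp
    · exact ⟨0, fun h ↦ absurd h hJ⟩
  choose b hb using hex
  choose E hE using fun a ↦ exists_forall_valuation_le_pow w a (hintegral a)
  -- A single exponent bounding the growth of all the finitely many coefficients `b J s i` with `s <
  -- n`.
  let N : ℕ := (Finset.univ ×ˢ (Finset.range n ×ˢ Finset.univ)).sup
    fun x : Finset (Fin n) × ℕ × Fin n ↦ E (b x.1 x.2.1 x.2.2)
  have hN (J s i) (hs : s < n) : E (b J s i) ≤ N :=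
    Finset.le_sup (f := fun x : Finset (Fin n) × ℕ × Fin n ↦ E (b x.1 x.2.1 x.2.2))
      (b := (J, s, i)) (by simpa using hs)
  refine ⟨fun i ↦ W i ^ N, fun a ↦ isIntegral_of_forall_valuationSubring _ a
    fun K _ _ φ V hV ↦ ?_⟩
  let v : Valuation A V.ValueGroup := V.valuation.comap φ
  have hvφ (a : A) : v a = V.valuation (φ a) := rfl
  have hkV (c : k) : φ (algebraMap k A c) ∈ V := hV _ (Subalgebra.algebraMap_mem _ c)
  have hk (c : k) : v (algebraMap k A c) ≤ 1 := (V.valuation_le_one_iff _).mpr (hkV c)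
  have ht (i) : v (z i + (z i * W i ^ N) ^ p) ≤ 1 :=
    (V.valuation_le_one_iff _).mpr (hV _ (Algebra.subset_adjoin ⟨i, rfl⟩))
  suffices hsuff : ∀ s, v (w s) ≤ 1 by
    have h1 := hE a _ v 1 hk le_rfl hsuff
    rw [one_pow] at h1
    exact (V.valuation_le_one_iff _).mp h1
  by_contra! hcon
  obtain ⟨s₁, hs₁⟩ := hcon
  have hs₁n : s₁ < n := by
    by_contra! hle
    simp [hw0 s₁ hle] at hs₁
  obtain ⟨s₀, hs₀, hmax⟩ := (Finset.range n).exists_max_image (fun s ↦ v (w s))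
    ⟨s₁, Finset.mem_range.mpr hs₁n⟩
  set M := v (w s₀) with hMdef
  have hM1 : 1 < M := hs₁.trans_le (hmax s₁ (Finset.mem_range.mpr hs₁n))
  have hM0 : 0 < M := zero_lt_one.trans hM1
  have hM (s) : v (w s) ≤ M := by
    by_cases hs : s < n
    · exact hmax s (Finset.mem_range.mpr hs)
    · simp [hw0 s (not_lt.mp hs)]
  let J : Finset (Fin n) := Finset.univ.filter fun i ↦ M ≤ v (W i)
  -- Otherwise `z i * W i ^ N` has value greater than `1` and at least `v (z i)`; its `p`-th power
  -- then strictly dominates `z i`, and `t i` is not integral.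
  have hzJ (i) (hi : i ∈ J) : M ^ N * v (z i) ≤ 1 := by
    have hWi : M ≤ v (W i) := by simpa [J] using hi
    by_contra! hlt
    have h1 : 1 < v (z i * W i ^ N) := by
      refine hlt.trans_le ?_
      rw [map_mul, map_pow, mul_comm]
      gcongr
    have h2 : v (z i) ≤ v (z i * W i ^ N) := by
      rw [map_mul, map_pow]
      exact le_mul_of_one_le_right' (one_le_pow₀ (hM1.le.trans hWi))
    have h3 : v (z i) < v ((z i * W i ^ N) ^ p) := by
      rw [map_pow]
      exact h2.trans_lt (lt_self_pow₀ h1 hp)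
    refine (ht i).not_gt ?_
    rw [Valuation.map_add_eq_of_lt_right _ h3, map_pow]
    exact one_lt_pow₀ h1 (by omega)
  -- Here `w s` is a combination of the `z i` with `i ∈ J`, whose coefficients have value at most `M
  -- ^ N`.
  have hsmall (s) (hs : n ≤ J.card + s) : v (w s) ≤ 1 := by
    by_cases hsn : s < n
    swap
    · simp [hw0 s (not_lt.mp hsn)]
    rw [hb J s hs]
    refine v.map_sum_le fun i hi ↦ ?_
    rw [map_mul]
    refine le_trans ?_ (hzJ i hi)
    gcongr
    exact (hE _ _ v M hk hM1.le hM).trans (pow_le_pow_right₀ hM1.le (hN J s i hsn))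
  let : Algebra k K := (φ.comp (algebraMap k A)).toAlgebra
  have halg (c : k) : algebraMap k K c = φ (algebraMap k A c) := rfl
  let L : Subfield K := (algebraicClosure k K).toSubfield
  have hL (x) (hx : x ∈ L) : x ∈ V := mem_valuationSubring_of_isAlgebraic V hkV
    (mem_algebraicClosure_iff.mp hx)
  have hnode (i : Fin n) : ∃ x ∈ L, i ∉ J →
      Polynomial.aeval x (P i) = 0 ∧ V.valuation ((G.map φ).eval x) < M := by
    by_cases hi : i ∈ J
    · exact ⟨0, zero_mem _, fun h ↦ absurd hi h⟩
    have hlt : v (W i) < M := by simpa [J] using hi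
    have hmapP : ((P i).map (algebraMap k A)).map φ = (P i).map (algebraMap k K) := by
      rw [Polynomial.map_map]; rfl
    have hres : φ (W i) = (((P i).map (algebraMap k K)).roots.map (G.map φ).eval).prod := by
      rw [← Polynomial.resultant_map_map, hmapP,
        ← (hPm i).natDegree_map (algebraMap k K), Polynomial.resultant_eq_prod_eval _ _ _
          (Polynomial.natDegree_map_le.trans hG) (IsAlgClosed.splits _),
          ((hPm i).map _).leadingCoeff,
        one_pow, one_mul]
    -- If `G` had value at least `M` at every root, the product would be at least `M ^ deg (P i) ≥
    -- M`, since the degree is positive and `M > 1`.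
    have hroot : ∃ x ∈ ((P i).map (algebraMap k K)).roots, V.valuation ((G.map φ).eval x) < M := by
      by_contra! hcon
      refine hlt.not_ge ?_
      rw [hvφ, hres, map_multiset_prod, Multiset.map_map]
      refine le_trans ?_ (Multiset.pow_card_le_prod (a := M) ?_)
      · refine le_self_pow₀ hM1.le ?_
        rw [Multiset.card_map, ← (IsAlgClosed.splits _).natDegree_eq_card_roots,
          (hPm i).natDegree_map]
        exact hPd i
      · intro y hy
        obtain ⟨x, hx, rfl⟩ := Multiset.mem_map.mp hy
        exact hcon x hx
    obtain ⟨x, hx, hxM⟩ := hroot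
    have hx0 : Polynomial.aeval x (P i) = 0 := by
      simpa [Polynomial.aeval_def] using (Polynomial.mem_roots'.mp hx).2
    exact ⟨x, mem_algebraicClosure_iff.mpr ⟨P i, (hPm i).ne_zero, hx0⟩, fun _ ↦ ⟨hx0, hxM⟩⟩
  choose node hnodeL hnode using hnode
  -- The truncation of `G` below degree `n - |J|`. The discarded coefficients are integral by
  -- `hsmall`, so `Q` is still smaller than `M` at the nodes, which are as many as its coefficients.
  let Q : Polynomial K := ∑ s ∈ Finset.range Jᶜ.card, Polynomial.C (φ (w s)) * Polynomial.X ^ s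
  have hcard : Jᶜ.card + J.card = n := by
    rw [add_comm, Finset.card_add_card_compl, Fintype.card_fin]
  have hinj : Set.InjOn node (Jᶜ : Finset (Fin n)) := by
    intro i hi j hj hij
    by_contra hne
    obtain ⟨a, c, hac⟩ := hPc (fun h ↦ hne (Fin.ext h) : (i : ℕ) ≠ j)
    have hi0 := (hnode i (by simpa using hi)).1
    have hj0 := (hnode j (by simpa using hj)).1
    have := congrArg (Polynomial.aeval (node i)) hac
    rw [map_add, map_mul, map_mul, hi0, hij, hj0] at this
    simp at this
  have hQdeg : Q.degree < Jᶜ.card := by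
    rw [← Polynomial.mem_degreeLT]
    refine sum_mem fun s hs ↦ ?_
    rw [Polynomial.mem_degreeLT]
    exact (Polynomial.degree_C_mul_X_pow_le _ _).trans_lt
      (by exact_mod_cast Finset.mem_range.mp hs)
  have hQeval (i) (hi : i ∈ Jᶜ) : V.valuation (Q.eval (node i)) < M := by
    have hsub : Q.eval (node i) = (G.map φ).eval (node i) -
        ∑ s ∈ Finset.Ico Jᶜ.card n, φ (w s) * node i ^ s := by
      rw [Finset.sum_Ico_eq_sub _ (by omega : Jᶜ.card ≤ n)]
      simp [Q, G, Polynomial.eval_finsetSum, Polynomial.map_sum]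
    rw [hsub]
    refine V.valuation.map_sub_lt (hnode i (by simpa using hi)).2 ?_
    refine V.valuation.map_sum_lt hM0.ne' fun s hs ↦ ?_
    rw [map_mul, map_pow]
    refine lt_of_le_of_lt (mul_le_one' (hsmall s ?_) (pow_le_one₀ zero_le ?_)) hM1
    · have := (Finset.mem_Ico.mp hs).1
      omega
    · exact (V.valuation_le_one_iff _).mpr (hL _ (hnodeL i))
  by_cases hs : s₀ < Jᶜ.card
  · have h := valuation_coeff_lt_of_eval_lt V L hL Jᶜ node hnodeL hinj Q hQdeg M hM0 hQeval s₀
    have hc : Q.coeff s₀ = φ (w s₀) := by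
      simp [Q, Polynomial.finsetSum_coeff, Polynomial.coeff_C_mul, Polynomial.coeff_X_pow, hs]
    rw [hc] at h
    exact h.false
  · exact (hsmall s₀ (by omega)).not_gt hM1

end PowerPerturbation

/-! ### Étale maps to affine space and differentials -/

section EtaleCoordinates

open scoped KaehlerDifferential

open KaehlerDifferential in
/-- A formally smooth algebra is formally étale over a polynomial ring if and only if the
differentials of the variables form a basis of its module of differentials. -/
theorem formallyEtale_mvPolynomial_iff {k A ι : Type*} [CommRing k] [CommRing A] [Algebra k A]
    [Algebra.FormallySmooth k A] [Algebra (MvPolynomial ι k) A]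
    [IsScalarTower k (MvPolynomial ι k) A] :
    Algebra.FormallyEtale (MvPolynomial ι k) A ↔ Function.Bijective
      (Finsupp.linearCombination A fun i ↦
        D k A (algebraMap (MvPolynomial ι k) A (MvPolynomial.X i))) := by
  let b := (mvPolynomialBasis k ι).baseChange A
  have hcomp : Finsupp.linearCombination A
      (fun i ↦ D k A (algebraMap (MvPolynomial ι k) A (MvPolynomial.X i))) =
      mapBaseChange k (MvPolynomial ι k) A ∘ₗ b.repr.symm.toLinearMap := by
    ext i
    simp [b]
  rw [hcomp, LinearMap.coe_comp, LinearEquiv.coe_coe, b.repr.symm.bijective.of_comp_iff]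
  constructor
  · intro h
    exact (tensorKaehlerEquivOfFormallyEtale k (MvPolynomial ι k) A).bijective
  · intro h
    -- Both parts use the Jacobi–Zariski sequence: surjectivity kills the relative differentials,
    -- while injectivity and the vanishing of `H1Cotangent` of the formally smooth `k`-algebra `A`
    -- kill the relative `H1Cotangent`.
    refine ⟨?_, ?_⟩
    · refine subsingleton_of_forall_eq 0 fun x ↦ ?_
      obtain ⟨y, rfl⟩ := map_surjective k (MvPolynomial ι k) A x
      obtain ⟨w, rfl⟩ := h.2 y
      exact (exact_mapBaseChange_map k (MvPolynomial ι k) A).apply_apply_eq_zero w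
    · refine subsingleton_of_forall_eq 0 fun x ↦ ?_
      have h0 : Algebra.H1Cotangent.δ k (MvPolynomial ι k) A x = 0 := h.1 <| by
        rw [map_zero]
        exact (Algebra.H1Cotangent.exact_δ_mapBaseChange k
          (MvPolynomial ι k) A).apply_apply_eq_zero x
      obtain ⟨y, rfl⟩ := (Algebra.H1Cotangent.exact_map_δ k (MvPolynomial ι k) A x).mp h0
      rw [Subsingleton.elim y 0, map_zero]

/-- Quasi-finiteness passes to the extension of fraction fields, and over a field it means finite.
-/
theorem isAlgebraic_of_quasiFinite {R S : Type*} [CommRing R] [CommRing S] [IsDomain R]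
    [IsDomain S] [Algebra R S] [FaithfulSMul R S] [Algebra.QuasiFinite R S] :
    Algebra.IsAlgebraic R S := by
  have : FaithfulSMul R (FractionRing S) := by
    rw [faithfulSMul_iff_algebraMap_injective, IsScalarTower.algebraMap_eq R S (FractionRing S)]
    exact (IsFractionRing.injective S _).comp (FaithfulSMul.algebraMap_injective R S)
  let := FractionRing.liftAlgebra R (FractionRing S)
  have : Algebra.QuasiFinite R (FractionRing S) := .trans R S _
  have : Algebra.QuasiFinite (FractionRing R) (FractionRing S) :=
    .of_restrictScalars R (FractionRing R) (FractionRing S)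
  have : Module.Finite (FractionRing R) (FractionRing S) := .of_quasiFinite
  have : Algebra.IsAlgebraic R (FractionRing S) :=
    (IsFractionRing.comap_isAlgebraic_iff (K := FractionRing R)).mpr inferInstance
  exact Algebra.IsAlgebraic.tower_bot_of_injective (IsFractionRing.injective S (FractionRing S))

theorem isAlgebraic_adjoin_quotient_of_quasiFinite {k A ι : Type*} [Field k] [CommRing A]
    [Algebra k A] [Algebra (MvPolynomial ι k) A] [IsScalarTower k (MvPolynomial ι k) A]
    [Algebra.QuasiFinite (MvPolynomial ι k) A] (z : ι → A)
    (hz : ∀ i, algebraMap (MvPolynomial ι k) A (MvPolynomial.X i) = z i)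
    (q : Ideal A) [q.IsPrime] : Algebra.IsAlgebraic
      (Algebra.adjoin k (Set.range fun i ↦ Ideal.Quotient.mk q (z i))) (A ⧸ q) := by
  set R := Algebra.adjoin k (Set.range fun i ↦ Ideal.Quotient.mk q (z i))
  have hmem (F : MvPolynomial ι k) : algebraMap _ (A ⧸ q) F ∈ R := by
    have h1 : IsScalarTower.toAlgHom k (MvPolynomial ι k) (A ⧸ q) =
        MvPolynomial.aeval fun i ↦ Ideal.Quotient.mk q (z i) := by
      ext i
      simp [← hz i]
    have h2 := DFunLike.congr_fun h1 F
    simp only [IsScalarTower.coe_toAlgHom'] at h2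
    rw [h2]
    simp only [R, Algebra.adjoin_range_eq_range_aeval]
    exact ⟨F, rfl⟩
  let : Algebra (MvPolynomial ι k) R :=
    ((algebraMap (MvPolynomial ι k) (A ⧸ q)).codRestrict R hmem).toAlgebra
  have : IsScalarTower (MvPolynomial ι k) R (A ⧸ q) := .of_algebraMap_eq fun _ ↦ rfl
  have : Algebra.QuasiFinite R (A ⧸ q) := .of_restrictScalars (MvPolynomial ι k) R (A ⧸ q)
  exact isAlgebraic_of_quasiFinite

/-- An étale map from an affine scheme to an affine space over a field of characteristic `p`
can be modified to become finite étale, changing each coordinate `z i` by a `p`-th power of a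
multiple of `z i`. -/
theorem exists_finite_etale_aeval_add_pow {k : Type*} {A : Type u} [Field k] [CommRing A]
    [Algebra k A] (p : ℕ) [Fact p.Prime] [CharP k p] {n : ℕ} (z : Fin n → A)
    (hz : (MvPolynomial.aeval (R := k) z).toRingHom.Etale) :
    ∃ h : Fin n → A,
      (MvPolynomial.aeval (R := k) fun i ↦ z i + (z i * h i) ^ p).toRingHom.Finite ∧
      (MvPolynomial.aeval (R := k) fun i ↦ z i + (z i * h i) ^ p).toRingHom.Etale := by
  have hft : Algebra.Smooth k A := by
    algebraize [(MvPolynomial.aeval (R := k) z).toRingHom]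
    have : IsScalarTower k (MvPolynomial (Fin n) k) A :=
      .of_algebraMap_eq fun c ↦ ((MvPolynomial.aeval (R := k) z).commutes c).symm
    have : Algebra.Smooth k (MvPolynomial (Fin n) k) := ⟨inferInstance, inferInstance⟩
    exact Algebra.Smooth.comp k (MvPolynomial (Fin n) k) A
  have hbij : Function.Bijective
      (Finsupp.linearCombination A fun i ↦ KaehlerDifferential.D k A (z i)) := by
    algebraize [(MvPolynomial.aeval (R := k) z).toRingHom]
    have : IsScalarTower k (MvPolynomial (Fin n) k) A :=
      .of_algebraMap_eq fun c ↦ ((MvPolynomial.aeval (R := k) z).commutes c).symm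
    have h := (formallyEtale_mvPolynomial_iff (k := k) (A := A) (ι := Fin n)).mp inferInstance
    simpa [RingHom.algebraMap_toAlgebra] using h
  have hq (q : Ideal A) [q.IsPrime] : Algebra.IsAlgebraic
      (Algebra.adjoin k (Set.range fun i ↦ Ideal.Quotient.mk q (z i))) (A ⧸ q) := by
    algebraize [(MvPolynomial.aeval (R := k) z).toRingHom]
    have : IsScalarTower k (MvPolynomial (Fin n) k) A :=
      .of_algebraMap_eq fun c ↦ ((MvPolynomial.aeval (R := k) z).commutes c).symm
    exact isAlgebraic_adjoin_quotient_of_quasiFinite z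
      (fun i ↦ by simp [RingHom.algebraMap_toAlgebra]) q
  obtain ⟨h, hh⟩ := exists_forall_isIntegral_adjoin_add_pow (Fact.out : p.Prime).two_le z hq
  set t : Fin n → A := fun i ↦ z i + (z i * h i) ^ p with ht
  refine ⟨h, ?_⟩
  algebraize [(MvPolynomial.aeval (R := k) t).toRingHom]
  have : IsScalarTower k (MvPolynomial (Fin n) k) A :=
    .of_algebraMap_eq fun c ↦ ((MvPolynomial.aeval (R := k) t).commutes c).symm
  have : Algebra.FiniteType (MvPolynomial (Fin n) k) A := .of_restrictScalars_finiteType k _ A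
  have : Algebra.FinitePresentation (MvPolynomial (Fin n) k) A :=
    Algebra.FinitePresentation.of_finiteType.mp inferInstance
  constructor
  · have : Algebra.IsIntegral (MvPolynomial (Fin n) k) A := ⟨fun a ↦ by
      obtain ⟨f, hf, hfa⟩ := hh a
      have hl : f.map (Algebra.adjoin k (Set.range t)).subtype ∈
          Polynomial.lifts (MvPolynomial.aeval (R := k) t).toRingHom := by
        rw [Polynomial.lifts_iff_coeff_lifts]
        intro i
        rw [Polynomial.coeff_map]
        exact (Algebra.adjoin_range_eq_range_aeval k t).le (f.coeff i).2
      obtain ⟨g, hg, -, hgm⟩ := Polynomial.lifts_and_natDegree_eq_and_monic hl (hf.map _)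
      refine ⟨g, hgm, ?_⟩
      rw [← Polynomial.eval_map]
      refine (congrArg (Polynomial.eval a) hg).trans ?_
      rw [Polynomial.eval_map]
      exact hfa⟩
    exact Algebra.IsIntegral.finite
  -- The Leibniz rule gives the differential of a `p`-th power a factor `p`, which is zero.
  · have hD (i) : KaehlerDifferential.D k A (t i) = KaehlerDifferential.D k A (z i) := by
      have h0 (x : Ω[A⁄k]) : p • x = 0 := by
        rw [← Nat.cast_smul_eq_nsmul k, CharP.cast_eq_zero, zero_smul]
      rw [ht, map_add, Derivation.leibniz_pow, h0, add_zero]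
    have : Algebra.FormallyEtale (MvPolynomial (Fin n) k) A := by
      rw [formallyEtale_mvPolynomial_iff]
      simpa [RingHom.algebraMap_toAlgebra, hD] using hbij
    exact ⟨inferInstance, inferInstance⟩

end EtaleCoordinates

/-! ### Completing independent differentials to étale coordinates -/

section LocalCoordinates

open KaehlerDifferential

/-- Ensures that a basis of the fibre can be chosen among differentials of functions. -/
theorem span_range_one_tmul_D (k B K : Type*) [CommRing k] [CommRing B] [Algebra k B] [Field K]
    [Algebra B K] :
    Submodule.span K (Set.range fun b : B ↦ (1 : K) ⊗ₜ[B] D k B b) = ⊤ := by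
  refine top_le_iff.mp fun x _ ↦ ?_
  induction x with
  | zero => exact zero_mem _
  | add x y hx hy => exact add_mem (hx trivial) (hy trivial)
  | tmul c w =>
    have hw : w ∈ Submodule.span B (Set.range (D k B)) := by
      rw [span_range_derivation]; trivial
    rw [← mul_one c, ← smul_eq_mul, ← TensorProduct.smul_tmul']
    refine Submodule.smul_mem _ _ ?_
    clear * - hw
    induction hw using Submodule.span_induction with
    | mem w h =>
      obtain ⟨b, rfl⟩ := h
      exact Submodule.subset_span ⟨b, rfl⟩
    | zero => simp
    | add w w' _ _ h h' => rw [TensorProduct.tmul_add]; exact add_mem h h'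
    | smul b w _ h =>
      rw [TensorProduct.tmul_smul, ← algebraMap_smul K b]
      exact Submodule.smul_mem _ _ h

/-- If the differentials of elements of `B` form a basis of the fibre of `Ω` at a smooth point,
then they form a basis of the stalk of `Ω` at that point. -/
theorem bijective_linearCombination_D_localization {k B : Type u} [Field k] [CommRing B]
    [Algebra k B] [Algebra.FiniteType k B] (q : Ideal B) [q.IsPrime] [Algebra.IsSmoothAt k q]
    {ι : Type u} (z : ι → B)
    (hli : LinearIndependent q.ResidueField fun i ↦ (1 : q.ResidueField) ⊗ₜ[B] D k B (z i))
    (hsp : Submodule.span q.ResidueField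
      (Set.range fun i ↦ (1 : q.ResidueField) ⊗ₜ[B] D k B (z i)) = ⊤) :
    Function.Bijective (Finsupp.linearCombination (Localization.AtPrime q)
      fun i ↦ D k (Localization.AtPrime q) (algebraMap B _ (z i))) := by
  have : Algebra.FormallyEtale B (Localization.AtPrime q) := .of_isLocalization q.primeCompl
  have : Algebra.EssFiniteType B (Localization.AtPrime q) := .of_isLocalization _ q.primeCompl
  have : Algebra.EssFiniteType k (Localization.AtPrime q) := .comp k B _
  let e : q.ResidueField ⊗[B] Ω[B⁄k] ≃ₗ[q.ResidueField]
      q.ResidueField ⊗[Localization.AtPrime q] Ω[Localization.AtPrime q⁄k] :=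
    (TensorProduct.AlgebraTensorModule.cancelBaseChange B (Localization.AtPrime q)
      q.ResidueField q.ResidueField Ω[B⁄k]).symm ≪≫ₗ
    (TensorProduct.AlgebraTensorModule.congr (.refl _ _)
      (tensorKaehlerEquivOfFormallyEtale k B (Localization.AtPrime q)))
  have he (b : B) : e (1 ⊗ₜ D k B b) = 1 ⊗ₜ D k (Localization.AtPrime q) (algebraMap B _ b) := by
    simp [e]
  -- Nakayama's lemma: at a smooth point the stalk of `Ω` is finite and flat, so a basis of its
  -- fibre lifts to a basis.
  refine Module.IsLocalRing.linearCombination_bijective_of_flat _ ⟨?_, ?_⟩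
  · have := hli.map' e.toLinearMap e.ker
    rw [show e.toLinearMap ∘ (fun i ↦ 1 ⊗ₜ D k B (z i)) = _ from funext fun i ↦ he (z i)] at this
    exact this
  · rw [← LinearMap.range_eq_top, Finsupp.range_linearCombination]
    have := congrArg (Submodule.map e.toLinearMap) hsp
    rw [Submodule.map_span, Submodule.map_top, LinearEquiv.range, ← Set.range_comp] at this
    convert this using 3
    funext i
    exact (he (z i)).symm

theorem aeval_comp_equiv {k B ι κ : Type*} [CommRing k] [CommRing B] [Algebra k B]
    (z : κ → B) (e : ι ≃ κ) : (MvPolynomial.aeval (R := k) fun i ↦ z (e i)).toRingHom =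
      (MvPolynomial.aeval (R := k) z).toRingHom.comp
        (MvPolynomial.renameEquiv k e).toAlgHom.toRingHom := by
  have : (MvPolynomial.aeval (R := k) fun i ↦ z (e i)) =
      (MvPolynomial.aeval z).comp (MvPolynomial.renameEquiv k e).toAlgHom :=
    MvPolynomial.algHom_ext fun i ↦ by simp
  exact congrArg AlgHom.toRingHom this

/-- Functions with independent differentials at a smooth point can be completed to étale
coordinates in a neighbourhood of this point. -/
theorem exists_etale_coordinates {k B : Type u} [Field k] [CommRing B] [Algebra k B]
    [Algebra.FiniteType k B] (q : Ideal B) [q.IsPrime] [Algebra.IsSmoothAt k q] {m : ℕ}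
    (g : Fin m → B)
    (hg : LinearIndependent q.ResidueField fun i ↦ (1 : q.ResidueField) ⊗ₜ[B] D k B (g i)) :
    ∃ (n : ℕ) (z : Fin n → B) (σ : Fin m ↪ Fin n) (f : B), (∀ i, z (σ i) = g i) ∧ f ∉ q ∧
      ((algebraMap B (Localization.Away f)).comp
        (MvPolynomial.aeval (R := k) z).toRingHom).Etale := by
  let v : B → q.ResidueField ⊗[B] Ω[B⁄k] := fun b ↦ 1 ⊗ₜ D k B b
  have hginj : Function.Injective g := Function.Injective.of_comp (f := v) hg.injective
  have hg' : LinearIndepOn q.ResidueField v (Set.range g) :=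
    (linearIndepOn_range_iff hginj v).mpr hg
  obtain ⟨b, -, hgb, hspan, hli⟩ := exists_linearIndepOn_extension hg' (Set.subset_univ _)
  have hli' : LinearIndependent q.ResidueField fun i : b ↦ v i := hli
  have hsp : Submodule.span q.ResidueField (Set.range fun i : b ↦ v i) = ⊤ := by
    rw [← top_le_iff, ← span_range_one_tmul_D k B q.ResidueField, Submodule.span_le,
      ← Set.image_eq_range, ← Set.image_univ]
    exact hspan
  have hfin : Finite b := hli'.finite
  have hbij := bijective_linearCombination_D_localization q (fun i : b ↦ (i : B)) hli' hsp
  let φ : MvPolynomial b k →ₐ[k] B := MvPolynomial.aeval fun i : b ↦ (i : B)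
  algebraize [φ.toRingHom]
  have : IsScalarTower k (MvPolynomial b k) B :=
    .of_algebraMap_eq fun c ↦ (φ.commutes c).symm
  have : Algebra.FiniteType (MvPolynomial b k) B := .of_restrictScalars_finiteType k _ B
  have : Algebra.FinitePresentation (MvPolynomial b k) B :=
    Algebra.FinitePresentation.of_finiteType.mp inferInstance
  have : IsScalarTower k (MvPolynomial b k) (Localization.AtPrime q) :=
    .of_algebraMap_eq fun c ↦ by
      rw [IsScalarTower.algebraMap_apply (MvPolynomial b k) B, IsScalarTower.algebraMap_apply k B,
        IsScalarTower.algebraMap_apply k (MvPolynomial b k) B]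
  have hX (i : b) : algebraMap (MvPolynomial b k) (Localization.AtPrime q) (MvPolynomial.X i) =
      algebraMap B _ (i : B) := by
    rw [IsScalarTower.algebraMap_apply (MvPolynomial b k) B]
    simp [RingHom.algebraMap_toAlgebra, φ]
  have het : Algebra.IsEtaleAt (MvPolynomial b k) q := by
    refine formallyEtale_mvPolynomial_iff.mpr ?_
    simpa only [hX] using hbij
  -- Étaleness at `q` spreads out to a basic open neighbourhood.
  obtain ⟨f, hf, hetf⟩ := Algebra.exists_etale_of_isEtaleAt (R := MvPolynomial b k) q
  let e : b ≃ Fin (Nat.card b) := Finite.equivFin b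
  refine ⟨Nat.card b, fun i ↦ (e.symm i : B),
    ⟨fun i ↦ e ⟨g i, hgb ⟨i, rfl⟩⟩, fun i j hij ↦ hginj (congrArg Subtype.val (e.injective hij))⟩,
    f, fun i ↦ congrArg Subtype.val (e.symm_apply_apply _), hf, ?_⟩
  rw [aeval_comp_equiv (fun i : b ↦ (i : B)) e.symm, ← RingHom.comp_assoc]
  refine RingHom.Etale.stableUnderComposition _ _
    (RingHom.Etale.of_bijective (MvPolynomial.renameEquiv k e.symm).bijective) ?_
  have := RingHom.etale_algebraMap.mpr hetf
  rwa [IsScalarTower.algebraMap_eq (MvPolynomial b k) B] at this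

end LocalCoordinates

/-! ### Krull dimension and transcendence degree -/

section Dimension

/-- Incomparability gives one inequality, lying over and going up the other. -/
theorem ringKrullDim_eq_of_isIntegral {R S : Type*} [CommRing R] [CommRing S] [Algebra R S]
    [FaithfulSMul R S] [Algebra.IsIntegral R S] : ringKrullDim S = ringKrullDim R := by
  refine le_antisymm ?_ (iSup_le fun l ↦ ?_)
  · refine Order.krullDim_le_of_strictMono (PrimeSpectrum.comap (algebraMap R S)) fun I J hIJ ↦ ?_
    exact Ideal.IsIntegral.comap_lt_comap (R := R) hIJ
  · obtain ⟨P, hP⟩ := Algebra.IsIntegral.comap_surjective R S (RelSeries.head l)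
    have : P.asIdeal.LiesOver (RelSeries.head l).asIdeal := ⟨by rw [← hP]; rfl⟩
    obtain ⟨L, hL, -⟩ := Ideal.exists_ltSeries_of_hasGoingUp l P.asIdeal
    rw [← hL]
    exact le_iSup (fun p : LTSeries (PrimeSpectrum S) ↦ (p.length : WithBot ℕ∞)) L

theorem trdeg_eq_of_isAlgebraic_mvPolynomial {k K : Type*} [Field k] [CommRing K] [IsDomain K]
    [Algebra k K] {s : ℕ} [Algebra (MvPolynomial (Fin s) k) K]
    [IsScalarTower k (MvPolynomial (Fin s) k) K] [FaithfulSMul (MvPolynomial (Fin s) k) K]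
    [Algebra.IsAlgebraic (MvPolynomial (Fin s) k) K] : Algebra.trdeg k K = s := by
  have := lift_trdeg_add_eq (R := k) (S := MvPolynomial (Fin s) k) (A := K)
  rw [trdeg_eq_zero (R := MvPolynomial (Fin s) k)] at this
  simpa [MvPolynomial.trdeg_of_isDomain, eq_comm] using this

theorem ringKrullDim_eq_trdeg {k A : Type*} [Field k] [CommRing A] [IsDomain A] [Algebra k A]
    [Algebra.FiniteType k A] : ringKrullDim A = (Algebra.trdeg k A).toNat := by
  obtain ⟨s, g, hg, hintegral⟩ := exists_integral_inj_algHom_of_fg k A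
  algebraize [g.toRingHom]
  have : IsScalarTower k (MvPolynomial (Fin s) k) A :=
    .of_algebraMap_eq fun c ↦ (g.commutes c).symm
  have : Algebra.IsIntegral (MvPolynomial (Fin s) k) A := ⟨hintegral⟩
  have : FaithfulSMul (MvPolynomial (Fin s) k) A :=
    (faithfulSMul_iff_algebraMap_injective _ _).mpr hg
  rw [ringKrullDim_eq_of_isIntegral (R := MvPolynomial (Fin s) k),
    trdeg_eq_of_isAlgebraic_mvPolynomial (s := s), MvPolynomial.ringKrullDim_of_isNoetherianRing]
  simp

/-- Going down along a flat map: a prime below `q` lies over zero, and minimality makes it equal to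
`q`. -/
theorem under_eq_bot_of_mem_minimalPrimes {R S : Type*} [CommRing R] [CommRing S] [IsDomain R]
    [Algebra R S] [Module.Flat R S] {q : Ideal S} (hq : q ∈ minimalPrimes S) : q.under R = ⊥ := by
  have := hq.1.1
  obtain ⟨Q, hQ, hQp, hQo⟩ := Ideal.exists_ideal_le_liesOver_of_le (p := (⊥ : Ideal R)) q
    (bot_le (a := q.under R))
  have : Q = q := le_antisymm hQ (hq.2 ⟨hQp, bot_le⟩ hQ)
  rw [← this, ← hQo.over]

/-- Flatness makes the polynomial ring inject into `A ⧸ q`, and quasi-finiteness makes this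
extension algebraic. -/
theorem trdeg_quotient_eq_of_etale {k A : Type*} [Field k] [CommRing A] [Algebra k A] {n : ℕ}
    (z : Fin n → A) (hz : (MvPolynomial.aeval (R := k) z).toRingHom.Etale) {q : Ideal A}
    (hq : q ∈ minimalPrimes A) : Algebra.trdeg k (A ⧸ q) = n := by
  have := hq.1.1
  algebraize [(MvPolynomial.aeval (R := k) z).toRingHom]
  have : IsScalarTower k (MvPolynomial (Fin n) k) A :=
    .of_algebraMap_eq fun c ↦ ((MvPolynomial.aeval (R := k) z).commutes c).symm
  have : FaithfulSMul (MvPolynomial (Fin n) k) (A ⧸ q) := by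
    rw [faithfulSMul_iff_algebraMap_injective, RingHom.injective_iff_ker_eq_bot,
      IsScalarTower.algebraMap_eq _ A, ← RingHom.comap_ker, Ideal.Quotient.algebraMap_eq,
      Ideal.mk_ker]
    exact under_eq_bot_of_mem_minimalPrimes hq
  have : Algebra.QuasiFinite (MvPolynomial (Fin n) k) (A ⧸ q) :=
    .trans _ A _
  have := isAlgebraic_of_quasiFinite (R := MvPolynomial (Fin n) k) (S := A ⧸ q)
  exact trdeg_eq_of_isAlgebraic_mvPolynomial

/-- By `hfrac`, `K` is the fraction field of the image of `A`. With `K` a residue field, this makes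
the transcendence degree independent of the affine neighbourhood. `toNat` absorbs the universe
lifts. -/
theorem toNat_trdeg_quotient_ker {k : Type*} {A : Type u} {K : Type*} [Field k] [CommRing A]
    [Algebra k A] [Field K] [Algebra k K] [Algebra A K] [IsScalarTower k A K]
    (hfrac : ∀ y : K, ∃ a b : A, algebraMap A K b ≠ 0 ∧ y * algebraMap A K b = algebraMap A K a) :
    Cardinal.toNat (Algebra.trdeg k (A ⧸ RingHom.ker (algebraMap A K))) =
      Cardinal.toNat (Algebra.trdeg k K) := by
  set q := RingHom.ker (algebraMap A K)
  have : q.IsPrime := RingHom.ker_isPrime _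
  algebraize [RingHom.kerLift (algebraMap A K)]
  have : IsScalarTower A (A ⧸ q) K := .of_algebraMap_eq fun a ↦ rfl
  have : IsScalarTower k (A ⧸ q) K := .to₁₃₄ k A _ _
  have : FaithfulSMul (A ⧸ q) K :=
    (faithfulSMul_iff_algebraMap_injective _ _).mpr (RingHom.kerLift_injective _)
  have : Algebra.IsAlgebraic (A ⧸ q) K := ⟨fun y ↦ by
    obtain ⟨a, b, hb, h⟩ := hfrac y
    refine ⟨Polynomial.C (Ideal.Quotient.mk q b) * Polynomial.X -
      Polynomial.C (Ideal.Quotient.mk q a), fun h0 ↦ ?_, ?_⟩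
    · have := congrArg (Polynomial.coeff · 1) h0
      simp [Ideal.Quotient.eq_zero_iff_mem] at this
      exact hb this
    · have h1 (c : A) : algebraMap (A ⧸ q) K (Ideal.Quotient.mk q c) = algebraMap A K c := rfl
      simp [h1, mul_comm _ y, h]⟩
  have := lift_trdeg_add_eq (R := k) (S := A ⧸ q) (A := K)
  rw [trdeg_eq_zero (R := A ⧸ q)] at this
  simpa using congrArg Cardinal.toNat this

end Dimension

/-! ### Points of affine opens as primes; dimension of a component -/

section PointsAndPrimes

variable {X : Scheme.{u}} {V : X.Opens}

theorem ker_evaluation (hV : IsAffineOpen V) {x : X} (hx : x ∈ V) :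
    RingHom.ker (X.evaluation V x hx).hom = (hV.primeIdealOf ⟨x, hx⟩).asIdeal := by
  rw [hV.primeIdealOf_eq_map_closedPoint]
  ext a
  change IsLocalRing.residue _ (X.presheaf.germ V x hx a) = 0 ↔
    X.presheaf.germ V x hx a ∈ IsLocalRing.maximalIdeal _
  exact IsLocalRing.residue_eq_zero_iff _

theorem map_evaluation {U : X.Opens} (i : V ⟶ U) {x : X} (hx : x ∈ V) :
    X.presheaf.map i.op ≫ X.evaluation V x hx = X.evaluation U x (i.le hx) := by
  rw [← Scheme.germ_residue, ← Scheme.germ_residue, TopCat.Presheaf.germ_res_assoc]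

theorem exists_evaluation_mul_eq (hV : IsAffineOpen V) {x : X} (hx : x ∈ V)
    (y : X.residueField x) : ∃ a b : Γ(X, V), X.evaluation V x hx b ≠ 0 ∧
      y * X.evaluation V x hx b = X.evaluation V x hx a := by
  obtain ⟨s, rfl⟩ := IsLocalRing.residue_surjective y
  let := X.presheaf.algebra_section_stalk ⟨x, hx⟩
  have := hV.isLocalization_stalk ⟨x, hx⟩
  obtain ⟨⟨a, b⟩, h⟩ := IsLocalization.surj (hV.primeIdealOf ⟨x, hx⟩).asIdeal.primeCompl s
  refine ⟨a, b, fun h0 ↦ b.2 ?_, ?_⟩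
  · exact (ker_evaluation hV hx).le h0
  · have := congrArg (IsLocalRing.residue _) h
    rwa [map_mul] at this

theorem fromSpec_specializes_iff (hV : IsAffineOpen V) (P Q : PrimeSpectrum Γ(X, V)) :
    hV.fromSpec P ⤳ hV.fromSpec Q ↔ P ≤ Q :=
  hV.fromSpec.isOpenEmbedding.isInducing.specializes_iff.trans
    (PrimeSpectrum.le_iff_specializes P Q).symm

theorem primeIdealOf_le_iff (hV : IsAffineOpen V) (x y : V) :
    hV.primeIdealOf y ≤ hV.primeIdealOf x ↔ (y : X) ⤳ x := by
  rw [← fromSpec_specializes_iff hV, hV.fromSpec_primeIdealOf, hV.fromSpec_primeIdealOf]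

/-- An affine neighbourhood of the generic point of the smallest member of a chain contains all the
generic points of the chain, since they specialize to it. This turns the chain into a reversed chain
of primes. Conversely, the spectrum of each quotient embeds in the closure. -/
theorem topologicalKrullDim_closure_singleton (η : X) (d : WithBot ℕ∞)
    (hd : ∀ (V : X.Opens) (hV : IsAffineOpen V) (hη : η ∈ V),
      ringKrullDim (Γ(X, V) ⧸ (hV.primeIdealOf ⟨η, hη⟩).asIdeal) = d) :
    topologicalKrullDim (closure {η} : Set X) = d := by
  refine le_antisymm (iSup_le fun l ↦ ?_) ?_
  · have : QuasiSober (closure {η} : Set X) :=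
      isClosed_closure.isClosedEmbedding_subtypeVal.quasiSober
    set c : Fin (l.length + 1) → X := fun i ↦
      (irreducibleSetEquivPoints (l i) : (closure {η} : Set X))
    have hη (i) : η ⤳ c i := specializes_iff_mem_closure.mpr
      (irreducibleSetEquivPoints (l i) : (closure {η} : Set X)).2
    have hle (i j) : c j ⤳ c i ↔ l i ≤ l j := by
      exact (Topology.IsInducing.subtypeVal.specializes_iff).trans
        irreducibleSetEquivPoints.map_rel_iff
    obtain ⟨V, (hV : IsAffineOpen V), hcV, -⟩ :=
      Opens.isBasis_iff_nbhd.mp X.isBasis_affineOpens (Opens.mem_top (c 0))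
    have hmem (i) : c i ∈ V := ((hle 0 i).mpr (l.monotone (Fin.zero_le _))).mem_open V.2 hcV
    rw [← hd V hV ((hη 0).mem_open V.2 hcV), ringKrullDim_quotient]
    let L : LTSeries (PrimeSpectrum.zeroLocus (R := Γ(X, V))
        (hV.primeIdealOf ⟨η, (hη 0).mem_open V.2 hcV⟩).asIdeal) :=
      ⟨l.length, fun i ↦ ⟨hV.primeIdealOf ⟨c i.rev, hmem _⟩,
        (primeIdealOf_le_iff hV _ _).mpr (hη _)⟩, fun i ↦ by
        have h := l.strictMono (Fin.rev_lt_rev.mpr i.castSucc_lt_succ)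
        refine lt_of_le_not_ge ((primeIdealOf_le_iff hV _ _).mpr ((hle _ _).mpr h.le)) fun h' ↦ ?_
        exact h.not_ge ((hle _ _).mp ((primeIdealOf_le_iff hV _ _).mp h'))⟩
    exact le_iSup (fun p : LTSeries _ ↦ (p.length : WithBot ℕ∞)) L
  · obtain ⟨V, (hV : IsAffineOpen V), hηV, -⟩ :=
      Opens.isBasis_iff_nbhd.mp X.isBasis_affineOpens (Opens.mem_top η)
    rw [← hd V hV hηV, ← PrimeSpectrum.topologicalKrullDim_eq_ringKrullDim]
    set q := (hV.primeIdealOf ⟨η, hηV⟩).asIdeal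
    have h1 := hV.fromSpec.isOpenEmbedding.isInducing.comp
      (PrimeSpectrum.isClosedEmbedding_comap_of_surjective _ (Ideal.Quotient.mk q)
        Ideal.Quotient.mk_surjective).isInducing
    have h2 (y) : (hV.fromSpec ∘ PrimeSpectrum.comap (Ideal.Quotient.mk q)) y ∈ closure {η} := by
      rw [← specializes_iff_mem_closure]
      nth_rw 1 [← show hV.fromSpec _ = η from hV.fromSpec_primeIdealOf ⟨η, hηV⟩]
      refine (fromSpec_specializes_iff hV _ _).mpr ?_
      intro a ha
      have h0 : Ideal.Quotient.mk q a = 0 := Ideal.Quotient.eq_zero_iff_mem.mpr ha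
      change Ideal.Quotient.mk q a ∈ y.asIdeal
      exact h0 ▸ y.asIdeal.zero_mem
    exact (h1.codRestrict h2).topologicalKrullDim_le

theorem primeIdealOf_mem_minimalPrimes (hV : IsAffineOpen V) {η : X} (hη : η ∈ V)
    (h : closure {η} ∈ irreducibleComponents X) :
    (hV.primeIdealOf ⟨η, hη⟩).asIdeal ∈ minimalPrimes Γ(X, V) := by
  refine ⟨⟨inferInstance, bot_le⟩, fun Q hQ hle ↦ ?_⟩
  have hη' : hV.fromSpec (hV.primeIdealOf ⟨η, hη⟩) = η := hV.fromSpec_primeIdealOf _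
  have hy := (fromSpec_specializes_iff hV ⟨Q, hQ.1⟩ (hV.primeIdealOf ⟨η, hη⟩)).mpr hle
  rw [hη'] at hy
  refine (fromSpec_specializes_iff hV (hV.primeIdealOf ⟨η, hη⟩) ⟨Q, hQ.1⟩).mp ?_
  rw [hη']
  exact specializes_iff_closure_subset.mpr
    (h.2 isIrreducible_singleton.closure hy.closure_subset)

variable {k : Type u} [Field k] (π : X ⟶ Spec (.of k))

theorem finiteType_sections [LocallyOfFiniteType π] (hV : IsAffineOpen V) :
    letI := sectionsAlgebra π V
    Algebra.FiniteType k Γ(X, V) := by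
  have h := LocallyOfFiniteType.finiteType_appLE (f := π) (isAffineOpen_top _) hV le_top
  exact h.comp (RingHom.FiniteType.of_surjective _
    (Scheme.ΓSpecIso (.of k)).symm.commRingCatIsoToRingEquiv.surjective)

/-- The residue field at `η` carries the value found on the chart `V` to every other affine
neighbourhood of `η`. -/
theorem topologicalKrullDim_closure_eq_of_etale [LocallyOfFiniteType π] (hV : IsAffineOpen V)
    {η : X} (hη : η ∈ V) (h : closure {η} ∈ irreducibleComponents X) {n : ℕ}
    (z : Fin n → Γ(X, V))
    (hz : letI := sectionsAlgebra π V; (MvPolynomial.aeval (R := k) z).toRingHom.Etale) :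
    topologicalKrullDim (closure {η} : Set X) = n := by
  let : Algebra k (X.residueField η) :=
    ((Scheme.ΓSpecIso (.of k)).inv ≫ π.appTop ≫ X.evaluation ⊤ η trivial).hom.toAlgebra
  have key (W : X.Opens) (hW : IsAffineOpen W) (hηW : η ∈ W) :
      letI := sectionsAlgebra π W
      Cardinal.toNat (Algebra.trdeg k (Γ(X, W) ⧸ (hW.primeIdealOf ⟨η, hηW⟩).asIdeal)) =
        Cardinal.toNat (Algebra.trdeg k (X.residueField η)) := by
    let := sectionsAlgebra π W
    let : Algebra Γ(X, W) (X.residueField η) := (X.evaluation W η hηW).hom.toAlgebra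
    have : IsScalarTower k Γ(X, W) (X.residueField η) := .of_algebraMap_eq' <| by
      have h2 : π.appLE ⊤ W le_top ≫ X.evaluation W η hηW =
          π.appTop ≫ X.evaluation ⊤ η trivial := by
        simp only [Scheme.Hom.appLE, Category.assoc, map_evaluation]
        rfl
      change _ = ((Scheme.ΓSpecIso (.of k)).inv ≫
        π.appLE ⊤ W le_top ≫ X.evaluation W η hηW).hom
      rw [h2]
      rfl
    rw [← toNat_trdeg_quotient_ker (k := k) (exists_evaluation_mul_eq hW hηW),
      RingHom.algebraMap_toAlgebra, ker_evaluation hW hηW]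
  refine topologicalKrullDim_closure_singleton η n fun W hW hηW ↦ ?_
  let := sectionsAlgebra π W
  let := sectionsAlgebra π V
  have := finiteType_sections π hW
  rw [ringKrullDim_eq_trdeg (k := k), key W hW hηW, ← key V hV hη, trdeg_quotient_eq_of_etale z hz
    (primeIdealOf_mem_minimalPrimes hV hη h)]
  simp

end PointsAndPrimes

/-! ### Étale charts and their disjoint unions -/

section EtaleCharts

variable {X : Scheme.{u}} {k : Type u} [Field k] (π : X ⟶ Spec (.of k))

/-- An affine open subset with étale coordinates to affine `n`-space. -/
structure IsEtaleChart (U : X.Opens) {n : ℕ} (z : Fin n → Γ(X, U)) : Prop where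
  isAffineOpen : IsAffineOpen U
  etale : letI := sectionsAlgebra π U; (MvPolynomial.aeval (R := k) z).toRingHom.Etale

theorem aeval_map_sections {U W : X.Opens} (i : W ⟶ U) {n : ℕ} (z : Fin n → Γ(X, U)) :
    letI := sectionsAlgebra π U
    letI := sectionsAlgebra π W
    (MvPolynomial.aeval (R := k) fun j ↦ X.presheaf.map i.op (z j)).toRingHom =
      (X.presheaf.map i.op).hom.comp (MvPolynomial.aeval (R := k) z).toRingHom := by
  let := sectionsAlgebra π U
  let := sectionsAlgebra π W
  refine MvPolynomial.ringHom_ext (fun c ↦ ?_) fun j ↦ by simp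
  have h : π.appLE ⊤ U le_top ≫ X.presheaf.map i.op = π.appLE ⊤ W le_top :=
    π.appLE_map _ _
  have h2 := congrArg (fun f ↦ ((Scheme.ΓSpecIso (.of k)).inv ≫ f).hom c) h
  simpa [RingHom.algebraMap_toAlgebra] using h2.symm

theorem etale_aeval_map_basicOpen_iff {U W : X.Opens} (hU : IsAffineOpen U) (i : W ⟶ U)
    (f : Γ(X, U)) (hf : X.basicOpen f = W) {n : ℕ} (z : Fin n → Γ(X, U)) :
    letI := sectionsAlgebra π U
    letI := sectionsAlgebra π W
    (MvPolynomial.aeval (R := k) fun j ↦ X.presheaf.map i.op (z j)).toRingHom.Etale ↔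
      ((algebraMap Γ(X, U) (Localization.Away f)).comp
        (MvPolynomial.aeval (R := k) z).toRingHom).Etale := by
  let := sectionsAlgebra π U
  let := sectionsAlgebra π W
  subst hf
  let : Algebra Γ(X, U) Γ(X, X.basicOpen f) := (X.presheaf.map i.op).hom.toAlgebra
  have : IsLocalization.Away f Γ(X, X.basicOpen f) := hU.isLocalization_basicOpen f
  let e := IsLocalization.algEquiv (.powers f) (Localization.Away f) Γ(X, X.basicOpen f)
  have h1 : (X.presheaf.map i.op).hom =
      e.toRingEquiv.toRingHom.comp (algebraMap Γ(X, U) (Localization.Away f)) :=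
    RingHom.ext fun a ↦ (e.commutes a).symm
  have h2 : algebraMap Γ(X, U) (Localization.Away f) =
      e.symm.toRingEquiv.toRingHom.comp (X.presheaf.map i.op).hom :=
    RingHom.ext fun a ↦ (e.symm.commutes a).symm
  rw [aeval_map_sections]
  constructor
  · intro h
    rw [h2, RingHom.comp_assoc]
    exact RingHom.Etale.respectsIso.1 _ _ h
  · intro h
    rw [h1, RingHom.comp_assoc]
    exact RingHom.Etale.respectsIso.1 _ _ h

theorem exists_glue_of_disjoint {U W : X.Opens} (h : Disjoint U W) (a : Γ(X, U)) (b : Γ(X, W)) :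
    ∃ c : Γ(X, U ⊔ W), X.presheaf.map (homOfLE le_sup_left).op c = a ∧
      X.presheaf.map (homOfLE le_sup_right).op c = b := by
  have : Subsingleton Γ(X, U ⊓ W) := by
    rw [h.eq_bot]
    infer_instance
  let y := (X.sheaf.objSupIsoProdEqLocus U W).inv ⟨(a, b), Subsingleton.elim (α := Γ(X, U ⊓ W)) _ _⟩
  exact ⟨y, X.sheaf.objSupIsoProdEqLocus_inv_fst U W _, X.sheaf.objSupIsoProdEqLocus_inv_snd U W _⟩

theorem basicOpen_glue {U W : X.Opens} (c : Γ(X, U ⊔ W)) {a : Γ(X, U)} {b : Γ(X, W)}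
    (ha : X.presheaf.map (homOfLE le_sup_left).op c = a)
    (hb : X.presheaf.map (homOfLE le_sup_right).op c = b) :
    X.basicOpen c = X.basicOpen a ⊔ X.basicOpen b := by
  rw [← ha, ← hb, Scheme.basicOpen_res, Scheme.basicOpen_res, ← inf_sup_right]
  exact (inf_eq_right.mpr (X.basicOpen_le c)).symm

theorem IsEtaleChart.exists_sup {U W : X.Opens} (h : Disjoint U W) {n : ℕ} {z : Fin n → Γ(X, U)}
    {w : Fin n → Γ(X, W)} (hz : IsEtaleChart π U z) (hw : IsEtaleChart π W w) :
    ∃ v : Fin n → Γ(X, U ⊔ W), IsEtaleChart π (U ⊔ W) v ∧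
      ∀ j, X.basicOpen (v j) = X.basicOpen (z j) ⊔ X.basicOpen (w j) := by
  choose v hvz hvw using fun j ↦ exists_glue_of_disjoint h (z j) (w j)
  have haff := hz.isAffineOpen.sup_of_disjoint hw.isAffineOpen h
  refine ⟨v, ⟨haff, ?_⟩, fun j ↦ basicOpen_glue _ (hvz j) (hvw j)⟩
  -- The two complementary idempotents have `U` and `W` as basic opens, and étaleness is local for
  -- this cover.
  obtain ⟨e₁, h11, h12⟩ := exists_glue_of_disjoint h 1 0
  obtain ⟨e₂, h21, h22⟩ := exists_glue_of_disjoint h 0 1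
  have hb1 : X.basicOpen e₁ = U := by
    rw [basicOpen_glue e₁ h11 h12]; simp
  have hb2 : X.basicOpen e₂ = W := by
    rw [basicOpen_glue e₂ h21 h22]; simp
  let := sectionsAlgebra π (U ⊔ W)
  refine RingHom.Etale.ofLocalizationSpanTarget _ {e₁, e₂} ?_ ?_
  · rw [← haff.self_le_iSup_basicOpen_iff]
    exact sup_le (hb1.ge.trans (le_iSup_of_le ⟨e₁, by simp⟩ le_rfl))
      (hb2.ge.trans (le_iSup_of_le ⟨e₂, by simp⟩ le_rfl))
  · rintro ⟨r, rfl | rfl⟩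
    · refine (etale_aeval_map_basicOpen_iff π haff (homOfLE le_sup_left) r hb1 v).mp ?_
      simpa only [hvz] using hz.etale
    · refine (etale_aeval_map_basicOpen_iff π haff (homOfLE le_sup_right) r hb2 v).mp ?_
      simpa only [hvw] using hw.etale

end EtaleCharts

/-! ### Existence of charts at smooth points and the number of coordinates -/

section ChartsAtSmoothPoints

/-- Bridges the residue field of the scheme at a point and that of the corresponding prime. -/
theorem linearIndependent_one_tmul_of_isScalarTower {A K L M ι : Type*} [CommRing A] [Field K]
    [Field L] [AddCommGroup M] [Module A M] [Algebra A K] [Algebra A L] [Algebra K L]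
    [IsScalarTower A K L] (v : ι → M)
    (h : LinearIndependent L fun i ↦ (1 : L) ⊗ₜ[A] v i) :
    LinearIndependent K fun i ↦ (1 : K) ⊗ₜ[A] v i := by
  have h1 : LinearIndependent K fun i ↦ (1 : L) ⊗ₜ[A] v i :=
    h.restrict_scalars (smul_left_injective K one_ne_zero)
  refine .of_comp (TensorProduct.AlgebraTensorModule.map (Algebra.linearMap K L)
    (LinearMap.id : M →ₗ[A] M)) ?_
  convert h1
  simp

variable {X : Scheme.{u}} {k : Type u} [Field k] (π : X ⟶ Spec (.of k))

theorem isSmoothAt_primeIdealOf [LocallyOfFiniteType π] {x : X} (hx : x ∈ π.smoothLocus)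
    {V : X.Opens} (hV : IsAffineOpen V) (hxV : x ∈ V) :
    letI := sectionsAlgebra π V
    Algebra.IsSmoothAt k (hV.primeIdealOf ⟨x, hxV⟩).asIdeal := by
  have h := (formallySmooth_stalkMap_iff ⊤ (isAffineOpen_top _) V hV le_top hxV).mp hx
  let := (π.appLE ⊤ V le_top).hom.toAlgebra
  let := sectionsAlgebra π V
  let e := (Scheme.ΓSpecIso (.of k)).symm.commRingCatIsoToRingEquiv
  let : Algebra k Γ(Spec (.of k), ⊤) := e.toRingHom.toAlgebra
  have : Algebra.FormallySmooth k Γ(Spec (.of k), ⊤) :=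
    .of_equiv (AlgEquiv.ofRingEquiv (f := e) fun _ ↦ rfl : k ≃ₐ[k] _)
  have : IsScalarTower k Γ(Spec (.of k), ⊤) Γ(X, V) := .of_algebraMap_eq' rfl
  have : IsScalarTower k Γ(Spec (.of k), ⊤)
      (Localization.AtPrime (hV.primeIdealOf ⟨x, hxV⟩).asIdeal) := .to₁₂₄ _ _ Γ(X, V) _
  have : Algebra.FormallySmooth Γ(Spec (.of k), ⊤)
      (Localization.AtPrime (hV.primeIdealOf ⟨x, hxV⟩).asIdeal) := h
  exact .comp k Γ(Spec (.of k), ⊤) _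

theorem exists_isEtaleChart [LocallyOfFiniteType π] {x : X} (hx : x ∈ π.smoothLocus)
    {V : X.Opens} (hV : IsAffineOpen V) (hxV : x ∈ V) {m : ℕ} (g : Fin m → Γ(X, V))
    (hg : LinearIndependentDifferentialsAt π V x hxV g) :
    ∃ (U : X.Opens) (i : U ⟶ V) (n : ℕ) (z : Fin n → Γ(X, U)) (σ : Fin m ↪ Fin n),
      x ∈ U ∧ IsEtaleChart π U z ∧ ∀ j, z (σ j) = X.presheaf.map i.op (g j) := by
  let := sectionsAlgebra π V
  have := finiteType_sections π hV
  have := isSmoothAt_primeIdealOf π hx hV hxV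
  set q := (hV.primeIdealOf ⟨x, hxV⟩).asIdeal with hq
  have hker : RingHom.ker (X.evaluation V x hxV).hom = q := ker_evaluation hV hxV
  let := (X.evaluation V x hxV).hom.toAlgebra
  let := (Ideal.ResidueField.lift q (X.evaluation V x hxV).hom hker.ge (fun a ha ↦ by
    rw [Submonoid.mem_comap, IsUnit.mem_submonoid_iff, isUnit_iff_ne_zero]
    exact fun h0 ↦ ha (hker.le h0))).toAlgebra
  have : IsScalarTower Γ(X, V) q.ResidueField (X.residueField x) := .of_algebraMap_eq fun a ↦
    (Ideal.ResidueField.lift_algebraMap _ _ _ _ a).symm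
  obtain ⟨n, z, σ, f, hσ, hf, het⟩ := exists_etale_coordinates q g
    (linearIndependent_one_tmul_of_isScalarTower (L := X.residueField x) _ hg)
  refine ⟨X.basicOpen f, homOfLE (X.basicOpen_le f), n, _, σ, ?_, ⟨hV.basicOpen f,
    (etale_aeval_map_basicOpen_iff π hV (homOfLE (X.basicOpen_le f)) f rfl z).mpr het⟩,
    fun j ↦ by simp only [hσ]⟩
  rw [← X.evaluation_ne_zero_iff_mem_basicOpen x hxV]
  exact fun h0 ↦ hf (hker.le h0)

/-- Étale coordinates at a smooth point of a scheme of pure dimension `n` are `n` in number. -/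
theorem IsEtaleChart.eq_of_isPureDimensional [LocallyOfFiniteType π] {n d : ℕ}
    (hX : IsPureDimensional X d) {U : X.Opens} {z : Fin n → Γ(X, U)} (hz : IsEtaleChart π U z)
    {x : X} (hx : x ∈ U) : n = d := by
  let Z := irreducibleComponent x
  have hZ : IsIrreducible Z := isIrreducible_irreducibleComponent
  have hη : closure {hZ.genericPoint} = Z :=
    hZ.genericPoint_closure_eq.trans isClosed_irreducibleComponent.closure_eq
  have hηU : hZ.genericPoint ∈ U := by
    refine (specializes_iff_mem_closure.mpr ?_).mem_open U.2 hx
    rw [hη]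
    exact mem_irreducibleComponent
  have h := irreducibleComponent_mem_irreducibleComponents x
  change Z ∈ _ at h
  have h1 := hX Z h
  rw [← hη] at h1 h
  rw [topologicalKrullDim_closure_eq_of_etale π hz.isAffineOpen hηU h z hz.etale] at h1
  exact_mod_cast h1

end ChartsAtSmoothPoints

/-! ### A dense chart and the resulting morphism to affine space -/

section GlobalCoordinates

variable {X : Scheme.{u}} {k : Type u} [Field k] (π : X ⟶ Spec (.of k))

/-- Étale coordinates can be found away from a non-dense open subset of the smooth locus and from
finitely many divisors. -/
theorem exists_isEtaleChart_disjoint [LocallyOfFiniteType π] {n : ℕ} (hX : IsPureDimensional X n)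
    {m : ℕ} (D : Fin m → IrreducibleCloseds X) (hD : ∀ i, Order.coheight (D i) = 1)
    {U : X.Opens} (hU : ¬ (π.smoothLocus : Set X) ⊆ closure (U : Set X)) :
    ∃ (W : X.Opens) (w : Fin n → Γ(X, W)), (W : Set X).Nonempty ∧ Disjoint U W ∧
      IsEtaleChart π W w ∧ ∀ i, ∀ y ∈ W, y ∉ D i := by
  obtain ⟨y, hy, hyU⟩ := Set.not_subset.mp hU
  let O : X.Opens := π.smoothLocus ⊓ ⟨(closure (U : Set X))ᶜ, isClosed_closure.isOpen_compl⟩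
  let Z := irreducibleComponent y
  have hZ : IsIrreducible Z := isIrreducible_irreducibleComponent
  have hcl : closure {hZ.genericPoint} = Z :=
    hZ.genericPoint_closure_eq.trans isClosed_irreducibleComponent.closure_eq
  set η := hZ.genericPoint
  have hηO : η ∈ O := by
    refine (specializes_iff_mem_closure.mpr ?_).mem_open O.2 ⟨hy, hyU⟩
    rw [hcl]
    exact mem_irreducibleComponent
  -- A divisor through the generic point of a component would contain the component and so be
  -- maximal, of coheight `0` instead of `1`.
  have hηD (i) : η ∉ D i := fun h ↦ by
    have hle : Z ⊆ D i := by
      rw [← hcl]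
      exact (D i).isClosed.closure_subset_iff.mpr (by simpa using h)
    have hmax : IsMax (D i) := fun E hE ↦
      (irreducibleComponent_mem_irreducibleComponents y).2 E.isIrreducible
        (hle.trans (SetLike.coe_subset_coe.mpr hE)) |>.trans hle
    simpa [Order.coheight_eq_zero.mpr hmax] using hD i
  let O' : X.Opens := O ⊓ ⟨(⋃ i, (D i : Set X))ᶜ,
    (isClosed_iUnion_of_finite fun i ↦ (D i).isClosed).isOpen_compl⟩
  have hηO' : η ∈ O' := ⟨hηO, by simpa using hηD⟩
  obtain ⟨V, (hV : IsAffineOpen V), hηV, hVO⟩ :=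
    Opens.isBasis_iff_nbhd.mp X.isBasis_affineOpens hηO'
  obtain ⟨W, i, n', w, -, hηW, hw, -⟩ := exists_isEtaleChart π hηO.1 hV hηV
    (fun j : Fin 0 ↦ j.elim0) linearIndependent_empty_type
  obtain rfl := hw.eq_of_isPureDimensional π hX hηW
  have hWO : W ≤ O' := i.le.trans hVO
  refine ⟨W, w, ⟨η, hηW⟩, ?_, hw, fun i y hyW hyi ↦ (hWO hyW).2 (Set.mem_iUnion.mpr ⟨i, hyi⟩)⟩
  rw [← Opens.coe_disjoint, Set.disjoint_left]
  exact fun y hyU hyW ↦ (hWO hyW).1.2 (subset_closure hyU)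

/-- A maximal chart works: if it missed part of the smooth locus, adjoining a disjoint chart that
avoids all the divisors would enlarge it, with no new condition on the coordinates there. -/
theorem exists_isEtaleChart_subset_closure [LocallyOfFiniteType π] [QuasiCompact π] {n : ℕ}
    (hX : IsPureDimensional X n) {x : X} (hx : x ∈ π.smoothLocus) {m : ℕ}
    (D : Fin m → IrreducibleCloseds X) (hD : ∀ i, Order.coheight (D i) = 1)
    (hDx : IntersectTransverselyAt π D x) :
    ∃ (U : X.Opens) (z : Fin n → Γ(X, U)) (σ : Fin m ↪ Fin n), x ∈ U ∧ IsEtaleChart π U z ∧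
      (π.smoothLocus : Set X) ⊆ closure (U : Set X) ∧
      ∀ i, ∀ y ∈ U, y ∈ D i → y ∉ X.basicOpen (z (σ i)) := by
  obtain ⟨-, V, hxV, g, hg, hlin⟩ := hDx
  obtain ⟨U₀, i₀, n', z₀, σ, hxU₀, hz₀, hσ⟩ := exists_isEtaleChart π hx V.2 hxV g hlin
  obtain rfl := hz₀.eq_of_isPureDimensional π hX hxU₀
  let S : Set X.Opens := {U | x ∈ U ∧ ∃ z : Fin n' → Γ(X, U), IsEtaleChart π U z ∧
    ∀ i, ∀ y ∈ U, y ∈ D i → y ∉ X.basicOpen (z (σ i))}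
  have hS : U₀ ∈ S := by
    refine ⟨hxU₀, z₀, hz₀, fun i y hyU hyD hy ↦ ?_⟩
    rw [hσ, Scheme.basicOpen_res] at hy
    have h1 : (⟨D i, (D i).isClosed⟩ : Closeds X) ≤
        (Scheme.IdealSheafData.vanishingIdeal ⟨D i, (D i).isClosed⟩).support :=
      Scheme.IdealSheafData.le_support_iff_le_vanishingIdeal.mpr le_rfl
    have h2 := (Scheme.IdealSheafData.mem_support_iff_of_mem (i₀.le hyU)).mp (h1 hyD)
    rw [Scheme.mem_zeroLocus_iff] at h2
    exact h2 (g i) (by rw [hg i]; exact Ideal.mem_span_singleton_self _) hy.2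
  have : CompactSpace X := QuasiCompact.compactSpace_of_compactSpace π
  have : IsLocallyNoetherian X := LocallyOfFiniteType.isLocallyNoetherian π
  have : IsNoetherian X := {}
  obtain ⟨U, ⟨hxU, z, hz, hzD⟩, hmax⟩ :=
    WellFounded.has_min (r := (· > ·)) wellFounded_gt S ⟨U₀, hS⟩
  refine ⟨U, z, σ, hxU, hz, ?_, hzD⟩
  by_contra hcl
  obtain ⟨W, w, ⟨y, hy⟩, hdisj, hw, hwD⟩ := exists_isEtaleChart_disjoint π hX D hD hcl
  obtain ⟨v, hv, hvb⟩ := IsEtaleChart.exists_sup π hdisj hz hw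
  refine hmax (U ⊔ W) ⟨Or.inl hxU, v, hv, fun i y hy hyD hyb ↦ ?_⟩
    (left_lt_sup.mpr fun h ↦ Set.disjoint_left.mp (Opens.coe_disjoint.mpr hdisj) (h hy) hy)
  rw [hvb] at hyb
  rcases hyb with h | h
  · exact hzD i y (X.basicOpen_le _ h) hyD h
  · exact hwD i y (X.basicOpen_le _ h) hyD

/-- The morphism from an affine open subset to affine `n`-space given by `n` functions. -/
noncomputable def toAffineSpace (U : X.Opens) {n : ℕ} (t : Fin n → Γ(X, U)) :
    U.toScheme ⟶ affineSpace n k :=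
  letI := sectionsAlgebra π U
  U.toSpecΓ ≫ Spec.map (CommRingCat.ofHom
    (MvPolynomial.aeval (R := k) fun i : ULift.{u} (Fin n) ↦ t i.down).toRingHom) ≫
      (AffineSpace.SpecIso (ULift.{u} (Fin n)) (.of k)).inv

theorem toAffineSpace_over {U : X.Opens} (hU : IsAffineOpen U) {n : ℕ} (t : Fin n → Γ(X, U)) :
    toAffineSpace π U t ≫ (affineSpace n k ↘ Spec (.of k)) = U.ι ≫ π := by
  let := sectionsAlgebra π U
  have h1 : CommRingCat.ofHom MvPolynomial.C ≫ CommRingCat.ofHom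
      (MvPolynomial.aeval (R := k) fun i : ULift.{u} (Fin n) ↦ t i.down).toRingHom =
      (Scheme.ΓSpecIso (.of k)).inv ≫ π.appLE ⊤ U le_top := by
    ext c
    exact MvPolynomial.aeval_C _ c
  have h2 := IsAffineOpen.SpecMap_appLE_fromSpec π (isAffineOpen_top _) hU le_top
  rw [IsAffineOpen.fromSpec_top, Scheme.isoSpec_Spec_inv] at h2
  simp only [toAffineSpace, Category.assoc, AffineSpace.SpecIso_inv_over, ← Spec.map_comp, h1]
  rw [Spec.map_comp, h2, ← hU.isoSpec_hom, IsAffineOpen.isoSpec_hom_fromSpec_assoc]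

theorem toAffineSpace_mem_coordinateHyperplane {U : X.Opens} (hU : IsAffineOpen U) {n : ℕ}
    (t : Fin n → Γ(X, U)) (j : Fin n) (y : U) (hy : U.ι y ∉ X.basicOpen (t j)) :
    toAffineSpace π U t y ∈ coordinateHyperplane k j := by
  rw [coordinateHyperplane, Scheme.mem_zeroLocus_iff]
  rintro _ rfl h
  let := sectionsAlgebra π U
  let φ := (MvPolynomial.aeval (R := k) fun i : ULift.{u} (Fin n) ↦ t i.down).toRingHom
  let Q := Spec.map (CommRingCat.ofHom φ) (U.toSpecΓ y)
  have hQ : Q ∈ (AffineSpace.SpecIso (ULift.{u} (Fin n)) (.of k)).inv ⁻¹ᵁ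
      (affineSpace n k).basicOpen (AffineSpace.coord _ (ULift.up j)) := h
  rw [Scheme.preimage_basicOpen_top, AffineSpace.SpecIso_inv_appTop_coord,
    basicOpen_eq_of_affine] at hQ
  have hXj : MvPolynomial.X (ULift.up j) ∉ Q.asIdeal := hQ
  have htj : t j ∉ (hU.primeIdealOf y).asIdeal := fun h0 ↦ hXj <| by
    change φ (MvPolynomial.X (ULift.up j)) ∈ (hU.primeIdealOf y).asIdeal
    simpa [φ] using h0
  rw [← ker_evaluation hU y.2] at htj
  exact hy ((X.evaluation_ne_zero_iff_mem_basicOpen y.1 y.2 (t j)).mp htj)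

theorem isFinite_etale_toAffineSpace {U : X.Opens} (hU : IsAffineOpen U) {n : ℕ}
    (t : Fin n → Γ(X, U))
    (hfin : letI := sectionsAlgebra π U; (MvPolynomial.aeval (R := k) t).toRingHom.Finite)
    (het : letI := sectionsAlgebra π U; (MvPolynomial.aeval (R := k) t).toRingHom.Etale) :
    IsFinite (toAffineSpace π U t) ∧ Etale (toAffineSpace π U t) := by
  let := sectionsAlgebra π U
  have h := aeval_comp_equiv (k := k) t (Equiv.ulift.{u} (α := Fin n))
  let e := (MvPolynomial.renameEquiv k (Equiv.ulift.{u} (α := Fin n)))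
  have : IsIso U.toSpecΓ := inferInstanceAs (IsIso hU.isoSpec.hom)
  have h1 : IsFinite (Spec.map (CommRingCat.ofHom
    (MvPolynomial.aeval (R := k) fun i : ULift.{u} (Fin n) ↦ t i.down).toRingHom)) := by
    rw [IsFinite.SpecMap_iff]
    change RingHom.Finite (MvPolynomial.aeval (R := k) fun i ↦ t (Equiv.ulift i)).toRingHom
    rw [h]
    exact hfin.comp (.of_surjective _ e.surjective)
  have h2 : Etale (Spec.map (CommRingCat.ofHom
    (MvPolynomial.aeval (R := k) fun i : ULift.{u} (Fin n) ↦ t i.down).toRingHom)) := by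
    rw [HasRingHomProperty.Spec_iff (P := @Etale)]
    change RingHom.Etale (MvPolynomial.aeval (R := k) fun i ↦ t (Equiv.ulift i)).toRingHom
    rw [h]
    exact RingHom.Etale.stableUnderComposition _ _ (.of_bijective e.bijective) het
  unfold toAffineSpace
  exact ⟨inferInstance, inferInstance⟩

end GlobalCoordinates

end EtaleCovers

/-! ### The main theorem -/

open EtaleCovers in
theorem theorem2 (k : Type u) [Field k] (p : ℕ) [Fact p.Prime] [CharP k p]
    (X : Scheme.{u}) (π : X ⟶ Spec (.of k)) [IsSeparated π] [LocallyOfFiniteType π]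
    [QuasiCompact π] (n : ℕ) (hX : IsPureDimensional X n)
    (x : X) (hx : x ∈ π.smoothLocus)
    (m : ℕ) (D : Fin m → IrreducibleCloseds X) (hD : ∀ i, Order.coheight (D i) = 1)
    (hDx : IntersectTransverselyAt π D x) :
    ∃ (U : X.Opens) (f : U.toScheme ⟶ affineSpace n k) (σ : Fin m ↪ Fin n),
      x ∈ U ∧
      (π.smoothLocus : Set X) ⊆ closure (U : Set X) ∧
      (Dense (π.smoothLocus : Set X) → Dense (U : Set X)) ∧
      f ≫ (affineSpace n k ↘ Spec (.of k)) = U.ι ≫ π ∧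
      IsFinite f ∧ Etale f ∧
      ∀ (i : Fin m) (z : U), U.ι z ∈ D i → f z ∈ coordinateHyperplane k (σ i) := by
  obtain ⟨U, z, σ, hxU, hz, hcl, hzD⟩ := exists_isEtaleChart_subset_closure π hX hx D hD hDx
  let := sectionsAlgebra π U
  obtain ⟨h, hfin, het⟩ := exists_finite_etale_aeval_add_pow p z hz.etale
  obtain ⟨h1, h2⟩ := isFinite_etale_toAffineSpace π hz.isAffineOpen _ hfin het
  refine ⟨U, toAffineSpace π U fun i ↦ z i + (z i * h i) ^ p, σ, hxU, hcl,
    fun hd ↦ dense_closure.mp (hd.mono hcl), toAffineSpace_over π hz.isAffineOpen _, h1, h2,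
    fun i y hy ↦ toAffineSpace_mem_coordinateHyperplane π hz.isAffineOpen _ _ y fun hmem ↦ ?_⟩
  have hp := (Fact.out : p.Prime).ne_zero
  -- The new coordinate is a multiple of the old one, so it vanishes wherever the old one does, in
  -- particular on the divisor.
  have hfac : z (σ i) + (z (σ i) * h (σ i)) ^ p =
      z (σ i) * (1 + h (σ i) * (z (σ i) * h (σ i)) ^ (p - 1)) := by
    obtain ⟨q, rfl⟩ := Nat.exists_eq_succ_of_ne_zero hp
    simp only [Nat.succ_eq_add_one, Nat.add_sub_cancel]
    ring
  rw [hfac, Scheme.basicOpen_mul] at hmem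
  exact hzD i _ y.2 hy hmem.1
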